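/- Let $\mathbb S\subset\mathbb R$ be a finite set and let $Y=(Y_t)_{t\ge 0}$ be a right-continuous continuous-time Markov chain on $\mathbb S$ with transition rate matrix $G$ (so $G(x,y)\ge 0$ for $x\neq y$, $G(x,x)=-\sum_{y\ne x}G(x,y)$, and the transition matrices are $e^{tG}$); $\mathbb P_x,\mathbb E_x$ refer to the start $Y_0=x$. Let $L\in\mathbb R$, $D>0$ and $q\in\mathbb C$ with $\Re q>0$. With $\sup\emptyset=0$, $\inf\emptyset=\infty$, put $g^-_{L,t}=\sup\{s\le t: Y_s\ge L\}$ and $$\tau^-_{L,D}=\inf\{t\ge 0: 1_{\{Y_t<L\}}(t-g^-_{L,t})\ge D\},\quad \tau^+_L=\inf\{t: Y_t\ge L\},\quad \tau^-_L=\inf\{t:Y_t<L\}.$$ For $x,y,z\in\mathbb S$ define (with $e^{-q\tau}=0$ when $\tau=\infty$) $$h_n(q,x;y)=\mathbb E_x\big[e^{-q\tau^-_{L,D}}1_{\{Y_{\tau^-_{L,D}}=y\}}\big],\qquad h_n(q,x)=\mathbb E_x\big[e^{-q\tau^-_{L,D}}\big],$$ $$v_n(D,x;y)=\mathbb P_x[\tau_L^+\ge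 D,\ Y_D=y],\qquad v_n(D,x)=\mathbb P_x[\tau_L^+\ge D],$$ $$u_n^+(q,D,x;z)=\mathbb E_x\big[e^{-q\tau_L^+}1_{\{\tau_L^+<D\}}1_{\{Y_{\tau_L^+}=z\}}\big],\qquad u_n^-(q,x;z)=\mathbb E_x\big[e^{-q\tau_L^-}1_{\{Y_{\tau_L^-}=z\}}\big].$$ Then, for all $x,y\in\mathbb S$, $$h_n(q,x;y)=1_{\{x<L\}}e^{-qD}v_n(D,x;y)+1_{\{x<L\}}\sum_{z\ge L}u_n^+(q,D,x;z)h_n(q,z;y)+1_{\{x\ge L\}}\sum_{z<L}u_n^-(q,x;z)h_n(q,z;y),$$ $$h_n(q,x)=1_{\{x<L\}}e^{-qD}v_n(D,x)+1_{\{x<L\}}\sum_{z\ge L}u_n^+(q,D,x;z)h_n(q,z)+1_{\{x\ge L\}}\sum_{z<L}u_n^-(q,x;z)h_n(q,z),$$ and $h_n(q,x)=\sum_y h_n(q,x;y)$, $v_n(D,x)=\sum_y v_n(D,x;y)$. In matrix form, let $I_L^-=\mathrm{diag}(1_{\{x<L\}})_{x\in\mathbb S}$, $I_L^+=\mathrm{diag}(1_{\{x\ge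 L\}})_{x\in\mathbb S}$, and $$V=e^{D I_L^-G}I_L^-,\quad U_1^+=(qI_L^--I_L^-G+I_L^+)^{-1}I_L^+,\quad U_2^+=e^{-qD}e^{D I_L^-G}I_L^-U_1^+,\quad U^-=(qI_L^+-I_L^+G+I_L^-)^{-1}I_L^-,$$ $$U(q)=I_L^-U_1^+-I_L^-U_2^++I_L^+U^-.$$ The two matrices inverted here are invertible, and $$(v_n(D,x;y))_{x,y}=V,\quad (u_n^+(q,D,x;z))_{x,z}=U_1^+-U_2^+,\quad (u_n^-(q,x;z))_{x,z}=U^-.$$ Moreover $H(q)=(h_n(q,x;y))_{x,y}$ satisfies $H(q)=e^{-qD}I_L^-V+U(q)H(q)$, the matrix $I-U(q)$ is invertible, and $$H(q)=e^{-qD}(I-U(q))^{-1}I_L^-V,\qquad (h_n(q,x))_{x}=e^{-qD}(I-U(q))^{-1}V\mathbf 1,$$ where $\mathbf 1$ is the vector of ones. -/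

import Mathlib

open scoped NNReal ENNReal
open MeasureTheory

noncomputable section

namespace Parisian

/-- `G` is a transition rate matrix: `G x y` is the rate from `x` to `y ≠ x`, and
`G x x = - ∑_{y ≠ x} G x y`. -/
structure IsRateMatrix {S : Finset ℝ} (G : Matrix S S ℝ) : Prop where
  nonneg : ∀ x y, x ≠ y → 0 ≤ G x y
  diag : ∀ x, G x x = -∑ y with y ≠ x, G x y

/-- `Y` is, under the family of laws `P x` (`x` the initial state), a continuous time Markov chain
on the finite set `S ⊆ ℝ` with transition rate matrix `G`: it is a process with right continuous
paths, it starts from `x` under `P x`, and it has the Markov property with respect to its own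
filtration `σ(Y r, r ≤ s)`, with transition probabilities `exp (t G)`. -/
structure IsCTMC {S : Finset ℝ} {Ω : Type*} [MeasurableSpace Ω] (G : Matrix S S ℝ)
    (P : S → Measure Ω) (Y : ℝ≥0 → Ω → S) : Prop where
  rate : IsRateMatrix G
  prob : ∀ x, IsProbabilityMeasure (P x)
  meas : ∀ t, Measurable (Y t)
  right_cont : ∀ ω t, ContinuousWithinAt (fun s => Y s ω) (Set.Ici t) t
  start : ∀ x, P x {ω | Y 0 ω = x} = 1
  markov : ∀ (x : S) (s t : ℝ≥0) (A : Set Ω),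
    MeasurableSet[⨆ r : Set.Iic s, MeasurableSpace.comap (Y r) inferInstance] A →
    ∀ y z : S, (P x).real (A ∩ {ω | Y s ω = y} ∩ {ω | Y (s + t) ω = z}) =
      (P x).real (A ∩ {ω | Y s ω = y}) * NormedSpace.exp ((t : ℝ) • G) y z

/-- `inf A ∈ [0, ∞]` for a set `A` of times, with `inf ∅ = ∞`. -/
def firstTime (A : Set ℝ≥0) : ℝ≥0∞ := ⨅ t ∈ A, (t : ℝ≥0∞)

/-- `g⁻_{L,t} = sup {s ≤ t : f s ≥ L}` for a path `f`; in `ℝ≥0` one has `sSup ∅ = 0`. -/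
def lastAbove {S : Finset ℝ} (f : ℝ≥0 → S) (L : ℝ) (t : ℝ≥0) : ℝ≥0 :=
  sSup {s | s ≤ t ∧ L ≤ (f s : ℝ)}

/-- `1_{f t < L} (t - g⁻_{L,t})`, the age at time `t` of the excursion of `f` below `L`. -/
def ageBelow {S : Finset ℝ} (f : ℝ≥0 → S) (L : ℝ) (t : ℝ≥0) : ℝ :=
  if (f t : ℝ) < L then (t : ℝ) - (lastAbove f L t : ℝ) else 0

/-- The Parisian stopping time `τ⁻_{L,D}` of a path. -/
def parisianTime {S : Finset ℝ} (f : ℝ≥0 → S) (L : ℝ) (D : ℝ≥0) : ℝ≥0∞ :=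
  firstTime {t | (D : ℝ) ≤ ageBelow f L t}

/-- The first passage time `τ⁺_L = inf {t : f t ≥ L}` of a path. -/
def upTime {S : Finset ℝ} (f : ℝ≥0 → S) (L : ℝ) : ℝ≥0∞ := firstTime {t | L ≤ (f t : ℝ)}

/-- The first passage time `τ⁻_L = inf {t : f t < L}` of a path. -/
def downTime {S : Finset ℝ} (f : ℝ≥0 → S) (L : ℝ) : ℝ≥0∞ := firstTime {t | (f t : ℝ) < L}

/-- `e^{-q τ}`, with the value `0` at `τ = ∞`. -/
def expNeg (q : ℂ) (τ : ℝ≥0∞) : ℂ := if τ = ∞ then 0 else Complex.exp (-q * (τ.toReal : ℂ))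

section Quantities

variable {S : Finset ℝ} {Ω : Type*} [MeasurableSpace Ω] (P : S → Measure Ω) (Y : ℝ≥0 → Ω → S)

/-- `h(q, x; y) = E_x[e^{-q τ} 1_{Y_τ = y}]` with `τ = τ⁻_{L,D}` (the integrand is `0` when
`τ = ∞`). -/
def h (L : ℝ) (D : ℝ≥0) (q : ℂ) (x y : S) : ℂ :=
  ∫ ω, expNeg q (parisianTime (Y · ω) L D) *
    (if Y (parisianTime (Y · ω) L D).toNNReal ω = y then 1 else 0) ∂(P x)

/-- `h(q, x) = E_x[e^{-q τ}]` with `τ = τ⁻_{L,D}`. -/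
def hTot (L : ℝ) (D : ℝ≥0) (q : ℂ) (x : S) : ℂ :=
  ∫ ω, expNeg q (parisianTime (Y · ω) L D) ∂(P x)

/-- `v(D, x; y) = E_x[1_{τ⁺_L ≥ D} 1_{Y_D = y}]`. -/
def v (L : ℝ) (D : ℝ≥0) (x y : S) : ℝ :=
  (P x).real {ω | (D : ℝ≥0∞) ≤ upTime (Y · ω) L ∧ Y D ω = y}

/-- `v(D, x) = E_x[1_{τ⁺_L ≥ D}]`. -/
def vTot (L : ℝ) (D : ℝ≥0) (x : S) : ℝ :=
  (P x).real {ω | (D : ℝ≥0∞) ≤ upTime (Y · ω) L}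

/-- `u⁺(q, D, x; z) = E_x[e^{-q τ⁺_L} 1_{τ⁺_L < D} 1_{Y_{τ⁺_L} = z}]`. -/
def uUp (L : ℝ) (D : ℝ≥0) (q : ℂ) (x z : S) : ℂ :=
  ∫ ω, expNeg q (upTime (Y · ω) L) * (if upTime (Y · ω) L < (D : ℝ≥0∞) then 1 else 0) *
    (if Y (upTime (Y · ω) L).toNNReal ω = z then 1 else 0) ∂(P x)

/-- `u⁻(q, x; z) = E_x[e^{-q τ⁻_L} 1_{Y_{τ⁻_L} = z}]` (the integrand is `0` when `τ⁻_L = ∞`). -/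
def uDown (L : ℝ) (q : ℂ) (x z : S) : ℂ :=
  ∫ ω, expNeg q (downTime (Y · ω) L) *
    (if Y (downTime (Y · ω) L).toNNReal ω = z then 1 else 0) ∂(P x)

end Quantities

section Matrices

variable {S : Finset ℝ}

/-- `I_L⁻ = diag (1_{x < L})`. -/
def IBelow (S : Finset ℝ) (L : ℝ) : Matrix S S ℂ :=
  Matrix.diagonal fun x => if (x : ℝ) < L then 1 else 0

/-- `I_L⁺ = diag (1_{x ≥ L})`. -/
def IAbove (S : Finset ℝ) (L : ℝ) : Matrix S S ℂ :=
  Matrix.diagonal fun x => if L ≤ (x : ℝ) then 1 else 0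

/-- The rate matrix with complex entries. -/
def cx (G : Matrix S S ℝ) : Matrix S S ℂ := G.map Complex.ofReal

/-- `q I_L⁻ - I_L⁻ G + I_L⁺`. -/
def resolvBelow (G : Matrix S S ℝ) (L : ℝ) (q : ℂ) : Matrix S S ℂ :=
  q • IBelow S L - IBelow S L * cx G + IAbove S L

/-- `q I_L⁺ - I_L⁺ G + I_L⁻`. -/
def resolvAbove (G : Matrix S S ℝ) (L : ℝ) (q : ℂ) : Matrix S S ℂ :=
  q • IAbove S L - IAbove S L * cx G + IBelow S L

/-- `V = exp (I_L⁻ G D) I_L⁻`. -/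
def matV (G : Matrix S S ℝ) (L : ℝ) (D : ℝ≥0) : Matrix S S ℂ :=
  NormedSpace.exp (((D : ℝ) : ℂ) • (IBelow S L * cx G)) * IBelow S L

/-- `U₁⁺(q) = (q I_L⁻ - I_L⁻ G + I_L⁺)⁻¹ I_L⁺`. -/
def matU1 (G : Matrix S S ℝ) (L : ℝ) (q : ℂ) : Matrix S S ℂ :=
  (resolvBelow G L q)⁻¹ * IAbove S L

/-- `U₂⁺(q) = e^{-qD} exp (I_L⁻ G D) I_L⁻ U₁⁺(q)`. -/
def matU2 (G : Matrix S S ℝ) (L : ℝ) (D : ℝ≥0) (q : ℂ) : Matrix S S ℂ :=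
  Complex.exp (-q * ((D : ℝ) : ℂ)) •
    (NormedSpace.exp (((D : ℝ) : ℂ) • (IBelow S L * cx G)) * IBelow S L * matU1 G L q)

/-- `U⁻(q) = (q I_L⁺ - I_L⁺ G + I_L⁻)⁻¹ I_L⁻`. -/
def matUDown (G : Matrix S S ℝ) (L : ℝ) (q : ℂ) : Matrix S S ℂ :=
  (resolvAbove G L q)⁻¹ * IBelow S L

/-- `U(q) = I_L⁻ U₁⁺(q) - I_L⁻ U₂⁺(q) + I_L⁺ U⁻(q)`. -/
def matU (G : Matrix S S ℝ) (L : ℝ) (D : ℝ≥0) (q : ℂ) : Matrix S S ℂ :=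
  IBelow S L * matU1 G L q - IBelow S L * matU2 G L D q + IAbove S L * matUDown G L q

end Matrices

end Parisian

end

/-! The recursion is a decomposition at the first exit from one side of `L`. From `x < L`, either
the path stays below `L` up to time `D` and the clock rings at `D`, or it crosses before `D` and the
clock starts afresh from the crossing state. From `x ≥ L` nothing happens until the path enters the
region below, where the problem restarts.

Only the Markov property at fixed times is assumed. The strong Markov property at an exit time is
obtained by observing the chain on a grid of mesh `K / (n + 1)`: summing over the first grid point
outside the set `b` of allowed states, applying the Markov property there, and letting `n → ∞`.
Right continuity makes the first grid point outside `b` converge to the exit time from the right.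
With `p` the indicator matrix of `b` and `δ` the mesh, the grid probabilities are powers of `p * exp
(δ G)`, whose limits are explicit: the powers give the killed semigroup (`tendsto_skeleton_pow`),
and the discounted geometric sums give the resolvent formula (`tendsto_skeleton_geom_sum`).

Thus `IsCTMC.integral_exit_before` and its version without horizon, `IsCTMC.integral_exit`, serve
twice. With the indicator of the initial state as restarted functional they yield the matrices of
`u⁺` and `u⁻`; with the Parisian payoff they yield the recursion for `h`. The delicate point is that
the payoff restarted just after entering the region below must converge to the original one
(`tendsto_parisianVal_restart_below`).

The resolvents are invertible by strict diagonal dominance. So is `1 - U(q)`: its rows are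
discounted exit laws, and the exit time is almost surely positive, so each row of `U(q)` has
absolute sum below `1`. -/

noncomputable section

namespace Parisian

open Filter Topology TopologicalSpace

/-! ### Deterministic facts about right continuous paths -/

/-- A path in a discrete space is right continuous: it is constant to the right of each time. -/
def IsRightConst {α : Type*} (f : ℝ≥0 → α) : Prop := ∀ t, ∀ᶠ s in 𝓝[≥] t, f s = f t

/-- The path seen from time `s` on. -/
def shift {α : Type*} (s : ℝ≥0) (f : ℝ≥0 → α) : ℝ≥0 → α := fun u => f (s + u)

lemma tendsto_add_nhdsGE (s t : ℝ≥0) : Tendsto (fun u => s + u) (𝓝[≥] t) (𝓝[≥] (s + t)) := by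
  refine tendsto_nhdsWithin_of_tendsto_nhds_of_eventually_within _ ?_ ?_
  · exact ((continuous_const.add continuous_id).tendsto t).mono_left nhdsWithin_le_nhds
  · filter_upwards [self_mem_nhdsWithin] with u hu
    exact add_le_add_right (α := ℝ≥0) hu s

lemma IsRightConst.shift {α : Type*} {f : ℝ≥0 → α} (hf : IsRightConst f) (s : ℝ≥0) :
    IsRightConst (shift s f) := fun t => (tendsto_add_nhdsGE s t).eventually (hf (s + t))

/-- The set `A` contains every time at which it accumulates from the right. -/
def IsRightClosed (A : Set ℝ≥0) : Prop := ∀ t, (∃ᶠ s in 𝓝[≥] t, s ∈ A) → t ∈ A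

lemma firstTime_le {A : Set ℝ≥0} {t : ℝ≥0} (ht : t ∈ A) : firstTime A ≤ t := iInf₂_le t ht

lemma le_firstTime {A : Set ℝ≥0} {c : ℝ≥0∞} (h : ∀ t ∈ A, c ≤ (t : ℝ≥0∞)) : c ≤ firstTime A :=
  le_iInf₂ h

lemma firstTime_empty : firstTime ∅ = ∞ := by simp [firstTime]

lemma firstTime_eq_of_isLeast {A : Set ℝ≥0} {t : ℝ≥0} (h : IsLeast A t) : firstTime A = t :=
  le_antisymm (firstTime_le h.1) (le_firstTime fun s hs => by exact_mod_cast h.2 hs)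

/-- A nonempty set accumulates at its infimum from the right, so the infimum is attained. Hence
every finite first time considered below is a genuine minimum, and the path can be evaluated there.
-/
lemma IsRightClosed.eq_empty_or_isLeast {A : Set ℝ≥0} (hA : IsRightClosed A) :
    A = ∅ ∨ ∃ t, IsLeast A t := by
  rcases A.eq_empty_or_nonempty with h | ⟨a, ha⟩
  · exact Or.inl h
  right
  have hbdd : BddBelow A := OrderBot.bddBelow A
  refine ⟨sInf A, hA _ ?_, fun s hs => csInf_le hbdd hs⟩
  intro hev
  obtain ⟨u, hu, hsub⟩ := mem_nhdsGE_iff_exists_Ico_subset.1 hev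
  obtain ⟨s, hs, hsu⟩ := exists_lt_of_csInf_lt ⟨a, ha⟩ (show sInf A < u from hu)
  exact hsub ⟨csInf_le hbdd hs, hsu⟩ hs

lemma IsRightConst.isRightClosed {α : Type*} {f : ℝ≥0 → α} (hf : IsRightConst f) (p : α → Prop) :
    IsRightClosed {t | p (f t)} := by
  intro t ht
  obtain ⟨s, hs, hst⟩ := (ht.and_eventually (hf t)).exists
  simpa [hst] using hs

/-! ### The Parisian time -/

variable {S : Finset ℝ}

/-- The times at which the path has spent at least `D` below `L`. -/
def parisianSet (f : ℝ≥0 → S) (L : ℝ) (D : ℝ≥0) : Set ℝ≥0 :=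
  -- The path is below `L` on `(t - D, t]`, written additively to avoid truncated subtraction. The
  -- condition `D ≤ t` reflects `sup ∅ = 0`: an excursion in progress at time `0` is aged from time
  -- `0`.
  {t | D ≤ t ∧ ∀ u ≤ t, t < u + D → (f u : ℝ) < L}

lemma le_ageBelow_iff (f : ℝ≥0 → S) (L : ℝ) {D : ℝ≥0} (hD : 0 < D) (t : ℝ≥0) :
    (D : ℝ) ≤ ageBelow f L t ↔ t ∈ parisianSet f L D := by
  have hbdd : BddAbove {s | s ≤ t ∧ L ≤ (f s : ℝ)} := ⟨t, fun s hs => hs.1⟩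
  have hD' : (0 : ℝ) < D := by exact_mod_cast hD
  unfold ageBelow
  constructor
  · intro h
    split_ifs at h with h1
    · have h2 : (D : ℝ) + lastAbove f L t ≤ t := by linarith
      have h3 : D + lastAbove f L t ≤ t := by exact_mod_cast h2
      refine ⟨le_trans (le_self_add) h3, fun u hu hut => ?_⟩
      by_contra hc
      have h4 : u ≤ lastAbove f L t := le_csSup hbdd ⟨hu, not_lt.1 hc⟩
      have h5 : u + D ≤ t := by rw [add_comm]; exact (add_le_add_right h4 D).trans h3
      exact absurd hut (not_lt.2 h5)
    · linarith
  · rintro ⟨h1, h2⟩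
    have h3 : (f t : ℝ) < L := h2 t le_rfl (lt_add_of_pos_right t hD)
    rw [if_pos h3]
    have h4 : lastAbove f L t ≤ t - D := by
      refine csSup_le' fun s hs => ?_
      by_contra hc
      have : t < s + D := by
        have := not_le.1 hc
        exact (tsub_lt_iff_right h1).1 this
      exact absurd (h2 s hs.1 this) (not_lt.2 hs.2)
    have h5 : lastAbove f L t + D ≤ t := (le_tsub_iff_right h1).1 h4
    have h6 : (lastAbove f L t : ℝ) + D ≤ t := by exact_mod_cast h5
    linarith

lemma parisianTime_eq (f : ℝ≥0 → S) (L : ℝ) {D : ℝ≥0} (hD : 0 < D) :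
    parisianTime f L D = firstTime (parisianSet f L D) := by
  unfold parisianTime
  congr 1
  ext t
  exact le_ageBelow_iff f L hD t

/-- The age keeps growing as long as the path holds its current value. This openness to the right is
what allows dense times and slightly delayed restarts to be used. -/
lemma IsRightConst.eventually_mem_parisianSet {f : ℝ≥0 → S} (hf : IsRightConst f) {L : ℝ}
    {D : ℝ≥0} (hD : 0 < D) {t : ℝ≥0} (ht : t ∈ parisianSet f L D) :
    ∀ᶠ s in 𝓝[≥] t, s ∈ parisianSet f L D := by
  obtain ⟨v, hv, hsub⟩ := mem_nhdsGE_iff_exists_Ico_subset.1 (hf t)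
  have h0 : (f t : ℝ) < L := ht.2 t le_rfl (lt_add_of_pos_right t hD)
  filter_upwards [Ico_mem_nhdsGE hv] with s hs
  refine ⟨ht.1.trans hs.1, fun u hu hsu => ?_⟩
  rcases le_total u t with h | h
  · exact ht.2 u h (hs.1.trans_lt hsu)
  · have : f u = f t := hsub ⟨h, hu.trans_lt hs.2⟩
    rwa [this]

/-- The strict inequality `t < u + D` leaves room to replace `t` by a slightly later element of the
set that is still before `u + D`. -/
lemma IsRightConst.isRightClosed_parisianSet {f : ℝ≥0 → S} (hf : IsRightConst f) (L : ℝ)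
    {D : ℝ≥0} : IsRightClosed (parisianSet f L D) := by
  intro t ht
  have key : ∀ v, t < v → ∃ s, t ≤ s ∧ s < v ∧ s ∈ parisianSet f L D ∧ f s = f t := by
    intro v hv
    obtain ⟨s, hs, h1, h2⟩ :=
      (ht.and_eventually ((hf t).and (Ico_mem_nhdsGE hv))).exists
    exact ⟨s, h2.1, h2.2, hs, h1⟩
  refine ⟨le_of_forall_gt_imp_ge_of_dense fun v hv => ?_, fun u hu htu => ?_⟩
  · obtain ⟨s, -, hsv, hs, -⟩ := key v hv
    exact hs.1.trans hsv.le
  · obtain ⟨s, hts, hsv, hs, -⟩ := key (u + D) htu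
    exact hs.2 u (hu.trans hts) hsv

/-- `e^{-q τ} 1_{f τ = y}` with `τ` the Parisian time of `f`. -/
def parisianVal (L : ℝ) (D : ℝ≥0) (q : ℂ) (y : S) (f : ℝ≥0 → S) : ℂ :=
  expNeg q (parisianTime f L D) * (if f (parisianTime f L D).toNNReal = y then 1 else 0)

lemma expNeg_coe (q : ℂ) (t : ℝ≥0) : expNeg q t = Complex.exp (-q * ((t : ℝ) : ℂ)) := by
  simp [expNeg]

lemma expNeg_top (q : ℂ) : expNeg q ∞ = 0 := by simp [expNeg]

lemma norm_expNeg_coe (q : ℂ) (t : ℝ≥0) : ‖expNeg q t‖ = Real.exp (-q.re * t) := by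
  rw [expNeg_coe, Complex.norm_exp]
  simp

lemma norm_expNeg_le_one {q : ℂ} (hq : 0 < q.re) (τ : ℝ≥0∞) : ‖expNeg q τ‖ ≤ 1 := by
  induction τ with
  | top => simp [expNeg_top]
  | coe t =>
    rw [norm_expNeg_coe, Real.exp_le_one_iff]
    have : 0 ≤ q.re * t := by positivity
    linarith

lemma norm_expNeg_lt_one {q : ℂ} (hq : 0 < q.re) {τ : ℝ≥0∞} (hτ : 0 < τ) : ‖expNeg q τ‖ < 1 := by
  induction τ with
  | top => simp [expNeg_top]
  | coe t =>
    rw [norm_expNeg_coe, Real.exp_lt_one_iff]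
    have h1 : (0 : ℝ) < t := by exact_mod_cast hτ
    have : 0 < q.re * t := by positivity
    linarith

lemma expNeg_add (q : ℂ) (s t : ℝ≥0) : expNeg q ((s + t : ℝ≥0) : ℝ≥0∞) = expNeg q s * expNeg q t := by
  rw [expNeg_coe, expNeg_coe, expNeg_coe, ← Complex.exp_add]
  congr 1
  push_cast
  ring

lemma continuous_expNeg_coe (q : ℂ) : Continuous fun t : ℝ≥0 => expNeg q t := by
  simp only [expNeg_coe]
  fun_prop

lemma norm_parisianVal_le_one {q : ℂ} (hq : 0 < q.re) (L : ℝ) (D : ℝ≥0) (y : S)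
    (f : ℝ≥0 → S) : ‖parisianVal L D q y f‖ ≤ 1 := by
  unfold parisianVal
  split_ifs
  · simpa using norm_expNeg_le_one hq _
  · simp

lemma parisianVal_of_empty {f : ℝ≥0 → S} {L : ℝ} {D : ℝ≥0} (hD : 0 < D) (q : ℂ) (y : S)
    (h : parisianSet f L D = ∅) : parisianVal L D q y f = 0 := by
  simp [parisianVal, parisianTime_eq f L hD, h, firstTime_empty, expNeg_top]

lemma parisianVal_of_isLeast {f : ℝ≥0 → S} {L : ℝ} {D : ℝ≥0} (hD : 0 < D) (q : ℂ) (y : S)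
    {t : ℝ≥0} (h : IsLeast (parisianSet f L D) t) :
    parisianVal L D q y f = expNeg q t * (if f t = y then 1 else 0) := by
  simp [parisianVal, parisianTime_eq f L hD, firstTime_eq_of_isLeast h]

lemma parisianVal_eq_shift {f : ℝ≥0 → S} (hf : IsRightConst f) {L : ℝ} {D : ℝ≥0} (hD : 0 < D)
    (q : ℂ) (y : S) {s : ℝ≥0}
    (h : ∀ t, t ∈ parisianSet f L D ↔ ∃ u ∈ parisianSet (shift s f) L D, t = s + u) :
    parisianVal L D q y f = expNeg q s * parisianVal L D q y (shift s f) := by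
  rcases ((hf.shift s).isRightClosed_parisianSet L (D := D)).eq_empty_or_isLeast with h0 | ⟨t, ht⟩
  · have : parisianSet f L D = ∅ := by
      ext t
      simp [h, h0]
    rw [parisianVal_of_empty hD q y h0, parisianVal_of_empty hD q y this, mul_zero]
  · have : IsLeast (parisianSet f L D) (s + t) := by
      refine ⟨(h _).2 ⟨t, ht.1, rfl⟩, fun r hr => ?_⟩
      obtain ⟨u, hu, rfl⟩ := (h r).1 hr
      exact add_le_add_right (α := ℝ≥0) (ht.2 hu) s
    rw [parisianVal_of_isLeast hD q y ht, parisianVal_of_isLeast hD q y this, expNeg_add, mul_assoc]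
    rfl

/-- Since `D ≤ u`, the window of length `D` ending at `s + u` lies after `s`. Forgetting the path
before `s` can therefore only delay the ringing of the clock. -/
lemma add_mem_parisianSet {f : ℝ≥0 → S} {L : ℝ} {D s u : ℝ≥0}
    (hu : u ∈ parisianSet (shift s f) L D) : s + u ∈ parisianSet f L D := by
  refine ⟨hu.1.trans le_add_self, fun r hr h => ?_⟩
  have hsr : s ≤ r := by
    by_contra hc
    have h1 : r + D ≤ s + u := add_le_add (not_le.1 hc).le hu.1
    exact absurd h (not_lt.2 h1)
  obtain ⟨r', rfl⟩ := exists_add_of_le hsr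
  refine hu.2 r' (le_of_add_le_add_left hr) ?_
  rw [add_assoc] at h
  exact lt_of_add_lt_add_left h

lemma exists_shift_of_mem_parisianSet {f : ℝ≥0 → S} {L : ℝ} {D s t : ℝ≥0}
    (ht : t ∈ parisianSet f L D) (hst : s + D ≤ t) :
    ∃ u ∈ parisianSet (shift s f) L D, t = s + u := by
  obtain ⟨u, rfl⟩ := exists_add_of_le (le_self_add.trans hst)
  refine ⟨u, ⟨le_of_add_le_add_left hst, fun r hr h => ?_⟩, rfl⟩
  refine ht.2 (s + r) (add_le_add_right (α := ℝ≥0) hr s) ?_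
  rw [add_assoc]
  exact add_lt_add_right (α := ℝ≥0) h s

/-- Restarting the clock above `L`, before time `D`. -/
lemma parisianVal_restart_above {f : ℝ≥0 → S} (hf : IsRightConst f) {L : ℝ} {D : ℝ≥0}
    (hD : 0 < D) (q : ℂ) (y : S) {s : ℝ≥0} (hs : L ≤ (f s : ℝ)) (hsD : s < D) :
    parisianVal L D q y f = expNeg q s * parisianVal L D q y (shift s f) := by
  refine parisianVal_eq_shift hf hD q y fun t => ⟨fun ht => ?_, ?_⟩
  · refine exists_shift_of_mem_parisianSet ht ?_
    by_contra hc
    exact absurd (ht.2 s (hsD.le.trans ht.1) (not_le.1 hc)) (not_lt.2 hs)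
  · rintro ⟨u, hu, rfl⟩
    exact add_mem_parisianSet hu

/-- Restarting the clock just after the path enters `(-∞, L)`. -/
lemma tendsto_parisianVal_restart_below {f : ℝ≥0 → S} (hf : IsRightConst f) {L : ℝ} {D : ℝ≥0}
    (hD : 0 < D) (q : ℂ) (y : S) {T : ℝ≥0} (hT : ∀ u < T, L ≤ (f u : ℝ)) :
    Tendsto (fun s : ℝ≥0 => expNeg q s * parisianVal L D q y (shift s f)) (𝓝[≥] T)
      (𝓝 (parisianVal L D q y f)) := by
  -- The path is above `L` before `T`, so no window of length `D` can begin before `T`.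
  have hge : ∀ t ∈ parisianSet f L D, T + D ≤ t := by
    intro t ht
    have : T ≤ t - D := by
      refine le_of_forall_lt fun u hu => ?_
      by_contra hc
      obtain ⟨w, huw, hwT⟩ := exists_between hu
      have h1 : t < w + D := (tsub_lt_iff_right ht.1).1 ((not_lt.1 hc).trans_lt huw)
      rcases le_or_gt w t with hwt | hwt
      · exact absurd (ht.2 w hwt h1) (not_lt.2 (hT w hwT))
      · exact absurd (ht.2 t le_rfl (lt_add_of_pos_right t hD)) (not_lt.2 (hT t (hwt.trans hwT)))
    exact (le_tsub_iff_right ht.1).1 this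
  -- If the excursion entered at `T` survives for time `D`, a clock restarted at `s` slightly after
  -- `T` rings at `s + D`, and only a limit is available. Otherwise every ringing window starts a
  -- positive time after `T`, and the restart is exact for `s` close to `T`.
  by_cases hmem : T + D ∈ parisianSet f L D
  · have hleast : IsLeast (parisianSet f L D) (T + D) := ⟨hmem, hge⟩
    rw [parisianVal_of_isLeast hD q y hleast]
    have hshift : Tendsto (fun s => s + D) (𝓝[≥] T) (𝓝[≥] (T + D)) := by
      simpa [add_comm] using tendsto_add_nhdsGE D T
    have hev : ∀ᶠ s in 𝓝[≥] T, expNeg q ((s + D : ℝ≥0) : ℝ≥0∞) * (if f (T + D) = y then 1 else 0)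
        = expNeg q s * parisianVal L D q y (shift s f) := by
      filter_upwards [hshift.eventually (hf.eventually_mem_parisianSet hD hmem),
        hshift.eventually (hf (T + D))] with s h1 h2
      obtain ⟨u, hu, hsu⟩ := exists_shift_of_mem_parisianSet h1 le_rfl
      have hu' : u = D := (add_left_cancel hsu).symm
      subst hu'
      rw [parisianVal_of_isLeast hD q y ⟨hu, fun r hr => hr.1⟩, expNeg_add, mul_assoc, ← h2]
      rfl
    refine Tendsto.congr' hev ?_
    refine Tendsto.mul_const _ ?_
    exact ((continuous_expNeg_coe q).tendsto (T + D)).comp (hshift.mono_right nhdsWithin_le_nhds)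
  · have hex : ∃ v, T < v ∧ ∀ t ∈ parisianSet f L D, v + D ≤ t := by
      rcases (hf.isRightClosed_parisianSet L (D := D)).eq_empty_or_isLeast with h0 | ⟨t, ht⟩
      · exact ⟨T + 1, lt_add_one T, by simp [h0]⟩
      · have h1 : T + D < t := lt_of_le_of_ne (hge t ht.1) fun h => hmem (h ▸ ht.1)
        have h2 : D ≤ t := ht.1.1
        refine ⟨t - D, lt_tsub_iff_right.2 h1, fun r hr => ?_⟩
        rw [tsub_add_cancel_of_le h2]
        exact ht.2 hr
    obtain ⟨v, hv, hvt⟩ := hex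
    refine tendsto_const_nhds.congr' ?_
    filter_upwards [Ico_mem_nhdsGE hv] with s hs
    refine parisianVal_eq_shift hf hD q y fun t => ⟨fun ht => ?_, ?_⟩
    · exact exists_shift_of_mem_parisianSet ht ((add_le_add_left (α := ℝ≥0) hs.2.le D).trans (hvt t ht))
    · rintro ⟨u, hu, rfl⟩
      exact add_mem_parisianSet hu

lemma parisianVal_of_below {f : ℝ≥0 → S} {L : ℝ} {D : ℝ≥0} (hD : 0 < D) (q : ℂ) (y : S)
    (h : ∀ u ≤ D, (f u : ℝ) < L) :
    parisianVal L D q y f = expNeg q D * (if f D = y then 1 else 0) :=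
  parisianVal_of_isLeast hD q y ⟨⟨le_rfl, fun u hu _ => h u hu⟩, fun _ hr => hr.1⟩

lemma parisianVal_of_above {f : ℝ≥0 → S} {L : ℝ} {D : ℝ≥0} (hD : 0 < D) (q : ℂ) (y : S)
    (h : ∀ u, L ≤ (f u : ℝ)) : parisianVal L D q y f = 0 := by
  refine parisianVal_of_empty hD q y (Set.eq_empty_of_forall_notMem fun t ht => ?_)
  exact absurd (ht.2 t le_rfl (lt_add_of_pos_right t hD)) (not_lt.2 (h t))

/-! ### First exit along a grid -/

/-- The `k`-th point of the grid with `n + 1` steps on `[0, K]`. -/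
def gridPt (K : ℝ≥0) (n k : ℕ) : ℝ≥0 := k * (K / (n + 1))

lemma gridPt_self (K : ℝ≥0) (n : ℕ) : gridPt K n (n + 1) = K := by
  unfold gridPt
  push_cast
  field_simp

lemma gridPt_lt_iff {K : ℝ≥0} (hK : 0 < K) {n j k : ℕ} : gridPt K n j < gridPt K n k ↔ j < k := by
  have : 0 < K / (n + 1) := by positivity
  simp [gridPt, this]

lemma tendsto_gridPt_one (K : ℝ≥0) : Tendsto (fun n : ℕ => K / ((n : ℝ≥0) + 1)) atTop (𝓝 0) := by
  rw [← NNReal.tendsto_coe]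
  push_cast
  exact tendsto_const_div_atTop_nhds_zero_nat (K : ℝ) |>.comp (tendsto_add_atTop_nat 1) |>.congr
    fun n => by simp

lemma exists_gridPt_tendsto {K : ℝ≥0} (hK : 0 < K) (T : ℝ≥0) :
    ∃ k : ℕ → ℕ, Tendsto (fun n => gridPt K n (k n)) atTop (𝓝[≥] T) ∧
      ∀ n j, j < k n → gridPt K n j < T := by
  have hpos : ∀ n : ℕ, 0 < K / ((n : ℝ≥0) + 1) := fun n => by positivity
  -- The index of the first grid point at or after `T`.
  refine ⟨fun n => ⌈T / (K / ((n : ℝ≥0) + 1))⌉₊, ?_, fun n j hj => ?_⟩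
  · have hlow : ∀ n : ℕ, T ≤ gridPt K n ⌈T / (K / ((n : ℝ≥0) + 1))⌉₊ := fun n => by
      have := Nat.le_ceil (T / (K / ((n : ℝ≥0) + 1)))
      rwa [div_le_iff₀ (hpos n)] at this
    refine tendsto_nhdsWithin_of_tendsto_nhds_of_eventually_within _ ?_ (Eventually.of_forall hlow)
    refine tendsto_of_tendsto_of_tendsto_of_le_of_le tendsto_const_nhds
      (h := fun n : ℕ => T + K / ((n : ℝ≥0) + 1)) ?_ hlow fun n => ?_
    · simpa using tendsto_const_nhds.add (tendsto_gridPt_one K)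
    · have := (Nat.ceil_lt_add_one (show 0 ≤ T / (K / ((n : ℝ≥0) + 1)) from zero_le)).le
      calc gridPt K n _ ≤ (T / (K / ((n : ℝ≥0) + 1)) + 1) * (K / ((n : ℝ≥0) + 1)) :=
            mul_le_mul_left this _
        _ = T + K / ((n : ℝ≥0) + 1) := by
            rw [add_mul, one_mul, div_mul_cancel₀ _ (hpos n).ne']
  · have := Nat.lt_ceil.1 hj
    rwa [lt_div_iff₀ (hpos n)] at this

open Classical in
/-- The sum `∑_{k ≤ n} c (t_k) 1_{the first grid point at which f is outside b is t_k}`. -/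
def gridExit {α : Type*} (K : ℝ≥0) (b : α → Prop) (n : ℕ) (c : ℝ≥0 → ℂ) (f : ℝ≥0 → α) : ℂ :=
  ∑ k ∈ Finset.range (n + 1), if (∀ j < k, b (f (gridPt K n j))) ∧ ¬ b (f (gridPt K n k))
    then c (gridPt K n k) else 0

lemma gridExit_eq_zero {α : Type*} {K : ℝ≥0} (hK : 0 < K) {b : α → Prop} {f : ℝ≥0 → α}
    (h : ∀ t < K, b (f t)) (n : ℕ) (c : ℝ≥0 → ℂ) : gridExit K b n c f = 0 := by
  refine Finset.sum_eq_zero fun k hk => if_neg fun hc => hc.2 (h _ ?_)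
  conv_rhs => rw [← gridPt_self K n]
  exact (gridPt_lt_iff hK).2 (Finset.mem_range.1 hk)

/-- The path is constant just after `T`, so on a fine grid an exit at `T` is not missed: the first
grid point at or after `T` is also the first one seen outside `b`. It converges to `T` from the
right, so a right limit of `c` is enough. -/
lemma tendsto_gridExit {α : Type*} {K : ℝ≥0} (hK : 0 < K) {b : α → Prop} {f : ℝ≥0 → α}
    (hf : IsRightConst f) {T : ℝ≥0} (hT : IsLeast {t | ¬ b (f t)} T) (hTK : T < K)
    {c : ℝ≥0 → ℂ} {l : ℂ} (hc : Tendsto c (𝓝[≥] T) (𝓝 l)) :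
    Tendsto (fun n => gridExit K b n c f) atTop (𝓝 l) := by
  obtain ⟨k, hk, hkT⟩ := exists_gridPt_tendsto hK T
  refine (hc.comp hk).congr' ?_
  filter_upwards [hk.eventually (hf T), hk.eventually (Ico_mem_nhdsGE hTK)] with n h1 h2
  have hkn : k n < n + 1 := by
    rw [← gridPt_lt_iff hK (n := n), gridPt_self]
    exact h2.2
  have hb : ¬ b (f (gridPt K n (k n))) := by rw [h1]; exact hT.1
  unfold gridExit
  rw [Finset.sum_eq_single_of_mem (k n) (Finset.mem_range.2 hkn)]
  · refine (if_pos ⟨fun j hj => ?_, hb⟩).symm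
    by_contra hbj
    exact absurd (hT.2 hbj) (not_le.2 (hkT n j hj))
  · intro i _ hi
    refine if_neg fun hc => ?_
    rcases lt_or_gt_of_ne hi with h | h
    · exact absurd (hT.2 hc.2) (not_le.2 (hkT n i h))
    · exact hb (hc.1 _ h)

-- The events "first outside at the `k`-th point" are disjoint, so at most one term survives. The
-- bound is uniform in `n`, as dominated convergence requires.
open Classical in
lemma norm_gridExit_le {α : Type*} (K : ℝ≥0) (b : α → Prop) (n : ℕ) {c : ℝ≥0 → ℂ}
    (f : ℝ≥0 → α) {C : ℝ} (hC : 0 ≤ C) (hc : ∀ t, ‖c t‖ ≤ C) : ‖gridExit K b n c f‖ ≤ C := by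
  by_cases h : ∃ k, k ∈ Finset.range (n + 1) ∧ (∀ j < k, b (f (gridPt K n j))) ∧
      ¬ b (f (gridPt K n k))
  · obtain ⟨k, hk, hk1, hk2⟩ := h
    unfold gridExit
    rw [Finset.sum_eq_single_of_mem k hk]
    · rw [if_pos ⟨hk1, hk2⟩]
      exact hc _
    · intro i _ hi
      refine if_neg fun hc => ?_
      rcases lt_or_gt_of_ne hi with h | h
      · exact hc.2 (hk1 i h)
      · exact hk2 (hc.1 k h)
  · have : gridExit K b n c f = 0 :=
      Finset.sum_eq_zero fun k hk => if_neg fun hc => h ⟨k, hk, hc⟩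
    simpa [this] using hC

lemma eventually_exists_grid_exit {α : Type*} {K : ℝ≥0} (hK : 0 < K) {b : α → Prop}
    {f : ℝ≥0 → α} (hf : IsRightConst f) {T : ℝ≥0} (hT : ¬ b (f T)) (hTK : T < K) :
    ∀ᶠ n in atTop, ∃ j < n + 1, ¬ b (f (gridPt K n j)) := by
  obtain ⟨k, hk, -⟩ := exists_gridPt_tendsto hK T
  filter_upwards [hk.eventually (hf T), hk.eventually (Ico_mem_nhdsGE hTK)] with n h1 h2
  refine ⟨k n, ?_, by rwa [h1]⟩
  rw [← gridPt_lt_iff hK (n := n), gridPt_self]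
  exact h2.2

/-! ### The Markov property for functionals of the path -/

variable {S : Finset ℝ}

/-- The functional `F` agrees on right continuous paths with a functional that is measurable with
respect to the coordinates. -/
def IsPathMeasurable (F : (ℝ≥0 → S) → ℂ) : Prop :=
  ∃ Φ : (ℝ≥0 → S) → ℂ, Measurable Φ ∧ ∀ f, IsRightConst f → F f = Φ f

lemma measurable_expNeg (q : ℂ) : Measurable (expNeg q) := by
  unfold expNeg
  refine Measurable.ite (measurableSet_singleton _) measurable_const ?_
  fun_prop

open Classical in
/-- The Parisian time computed from the values of the path on a countable dense set. -/
def denseParisianTime (L : ℝ) (D : ℝ≥0) (f : ℝ≥0 → S) : ℝ≥0∞ :=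
  ⨅ n, if D ≤ denseSeq ℝ≥0 n ∧ ∀ m, denseSeq ℝ≥0 m ≤ denseSeq ℝ≥0 n →
      denseSeq ℝ≥0 n < denseSeq ℝ≥0 m + D → (f (denseSeq ℝ≥0 m) : ℝ) < L
    then (denseSeq ℝ≥0 n : ℝ≥0∞) else ∞

lemma measurable_denseParisianTime (L : ℝ) (D : ℝ≥0) :
    Measurable (denseParisianTime (S := S) L D) := by
  classical
  unfold denseParisianTime
  refine Measurable.iInf fun n => Measurable.ite ?_ measurable_const measurable_const
  refine MeasurableSet.const _ |>.inter (?_ : MeasurableSet {f : ℝ≥0 → S | ∀ m, _ → _ → _})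
  simp only [Set.ofPred_forall]
  refine MeasurableSet.iInter fun m => MeasurableSet.iInter fun _ => MeasurableSet.iInter fun _ => ?_
  exact measurableSet_lt (measurable_subtype_coe.comp (measurable_pi_apply _)) measurable_const

lemma exists_denseSeq_between {a b : ℝ≥0} (h : a < b) :
    ∃ n, a < denseSeq ℝ≥0 n ∧ denseSeq ℝ≥0 n < b := by
  obtain ⟨_, ⟨n, rfl⟩, h1⟩ := (denseRange_denseSeq ℝ≥0).exists_between h
  exact ⟨n, h1⟩

lemma IsRightConst.exists_denseSeq {α : Type*} {f : ℝ≥0 → α} (hf : IsRightConst f) {a b : ℝ≥0}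
    (h : a < b) : ∃ n, a < denseSeq ℝ≥0 n ∧ denseSeq ℝ≥0 n < b ∧ f (denseSeq ℝ≥0 n) = f a := by
  obtain ⟨v, hv, hsub⟩ := mem_nhdsGE_iff_exists_Ico_subset.1 (hf a)
  obtain ⟨n, h1, h2⟩ := exists_denseSeq_between (lt_min h (show a < v from hv))
  exact ⟨n, h1, h2.trans_le (min_le_left _ _), hsub ⟨h1.le, h2.trans_le (min_le_right _ _)⟩⟩

/-- One inequality holds because the ringing set is open to the right and so contains dense times
just after each of its elements. The other holds because right constancy transfers the condition at
an arbitrary `u` to a dense time just after `u`; the endpoint itself is a dense time. -/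
lemma IsRightConst.denseParisianTime_eq {f : ℝ≥0 → S} (hf : IsRightConst f) (L : ℝ) {D : ℝ≥0}
    (hD : 0 < D) : denseParisianTime L D f = parisianTime f L D := by
  rw [parisianTime_eq f L hD]
  refine le_antisymm (le_firstTime fun t ht => ?_) (le_iInf fun n => ?_)
  · refine le_of_forall_gt_imp_ge_of_dense fun v hv => ?_
    induction v with
    | top => exact le_top
    | coe v =>
      have htv : t < v := by exact_mod_cast hv
      obtain ⟨w, hw, hsub⟩ :=
        mem_nhdsGE_iff_exists_Ico_subset.1 (hf.eventually_mem_parisianSet hD ht)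
      obtain ⟨n, h1, h2⟩ := exists_denseSeq_between (lt_min htv (show t < w from hw))
      have hmem : denseSeq ℝ≥0 n ∈ parisianSet f L D :=
        hsub ⟨h1.le, h2.trans_le (min_le_right _ _)⟩
      refine (iInf_le _ n).trans ?_
      rw [if_pos ⟨hmem.1, fun m hm hm' => hmem.2 _ hm hm'⟩]
      exact_mod_cast (h2.trans_le (min_le_left _ _)).le
  · split_ifs with h
    · refine firstTime_le ⟨h.1, fun u hu hut => ?_⟩
      rcases hu.eq_or_lt with rfl | hu
      · exact h.2 n le_rfl hut
      · obtain ⟨m, h1, h2, h3⟩ := hf.exists_denseSeq hu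
        rw [← h3]
        exact h.2 m h2.le (hut.trans (add_lt_add_left (α := ℝ≥0) h1 D))
    · exact le_top

/-- The payoff involves uncountably many times, so a version built from countably many coordinates
is needed to integrate it against the law of the path. -/
lemma isPathMeasurable_parisianVal (L : ℝ) {D : ℝ≥0} (hD : 0 < D) (q : ℂ) (y : S) :
    IsPathMeasurable (parisianVal L D q y) := by
  classical
  refine ⟨fun f => expNeg q (denseParisianTime L D f) *
    -- The state at the random time `τ` is read off from the dense times in some interval
    -- immediately to the right of `τ`.
    if ∃ n, denseParisianTime L D f < denseSeq ℝ≥0 n ∧ ∀ m,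
        denseParisianTime L D f < denseSeq ℝ≥0 m → denseSeq ℝ≥0 m < denseSeq ℝ≥0 n →
        f (denseSeq ℝ≥0 m) = y then 1 else 0, ?_, ?_⟩
  · have hτ := measurable_denseParisianTime (S := S) L D
    refine ((measurable_expNeg q).comp hτ).mul (Measurable.ite ?_ measurable_const measurable_const)
    simp only [Set.ofPred_exists, Set.ofPred_and, Set.ofPred_forall]
    refine MeasurableSet.iUnion fun n => (measurableSet_lt hτ measurable_const).inter ?_
    refine MeasurableSet.iInter fun m => ?_
    simp only [imp_iff_not_or, Set.ofPred_or]
    exact (measurableSet_lt hτ measurable_const).compl.union ((MeasurableSet.const _).union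
      (measurableSet_eq_fun (measurable_pi_apply (denseSeq ℝ≥0 m)) measurable_const))
  · intro f hf
    beta_reduce
    rw [hf.denseParisianTime_eq L hD, parisianVal]
    generalize parisianTime f L D = τ
    induction τ with
    | top => simp [expNeg_top]
    | coe t =>
      congr 1
      refine if_congr ?_ rfl rfl
      simp only [ENNReal.toNNReal_coe, ENNReal.coe_lt_coe]
      constructor
      · rintro rfl
        obtain ⟨v, hv, hsub⟩ := mem_nhdsGE_iff_exists_Ico_subset.1 (hf t)
        obtain ⟨n, h1, h2⟩ := exists_denseSeq_between (show t < v from hv)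
        exact ⟨n, h1, fun m h3 h4 => hsub ⟨h3.le, h4.trans h2⟩⟩
      · rintro ⟨n, h1, h2⟩
        obtain ⟨m, h3, h4, h5⟩ := hf.exists_denseSeq h1
        rw [← h5]
        exact h2 m h3 h4

section Markov

variable {Ω : Type*}

/-- The `σ`-algebra `σ(Y r, r ≤ s)`. -/
abbrev past (Y : ℝ≥0 → Ω → S) (s : ℝ≥0) : MeasurableSpace Ω :=
  ⨆ r : Set.Iic s, MeasurableSpace.comap (Y r) inferInstance

lemma past_mono (Y : ℝ≥0 → Ω → S) {s t : ℝ≥0} (h : s ≤ t) : past Y s ≤ past Y t :=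
  iSup_le fun r => le_iSup_of_le (⟨r, le_trans r.2 h⟩ : Set.Iic t) le_rfl

lemma measurableSet_past (Y : ℝ≥0 → Ω → S) {r s : ℝ≥0} (h : r ≤ s) (B : Set S) :
    MeasurableSet[past Y s] {ω | Y r ω ∈ B} := by
  have : MeasurableSpace.comap (Y r) inferInstance ≤ past Y s :=
    le_iSup_of_le (⟨r, h⟩ : Set.Iic s) le_rfl
  exact this _ ⟨B, B.toFinite.measurableSet, rfl⟩

variable [MeasurableSpace Ω] {G : Matrix S S ℝ} {P : S → Measure Ω} {Y : ℝ≥0 → Ω → S}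

lemma IsCTMC.past_le (hY : IsCTMC G P Y) (s : ℝ≥0) : past Y s ≤ ‹MeasurableSpace Ω› :=
  iSup_le fun r => (hY.meas r).comap_le

lemma IsCTMC.isRightConst (hY : IsCTMC G P Y) (ω : Ω) : IsRightConst (Y · ω) := fun t =>
  (hY.right_cont ω t).eventually (by
    rw [nhds_discrete]
    exact Filter.eventually_pure.2 rfl : ∀ᶠ y in 𝓝 (Y t ω), y = Y t ω)

/-- The point is that `W` does not depend on `x`, `s` or `A`. The last observation time is added at
each step: all earlier observations join `A` in the past, and the one-step Markov property applies.
-/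
lemma IsCTMC.exists_fdd (hY : IsCTMC G P Y) (g : ℝ≥0 → S) (z : S) (I : Finset ℝ≥0) :
    ∃ W : ℝ, ∀ (x : S) (s : ℝ≥0) (A : Set Ω), MeasurableSet[past Y s] A →
      (P x).real (A ∩ {ω | Y s ω = z} ∩ {ω | ∀ i ∈ I, Y (s + i) ω = g i}) =
        (P x).real (A ∩ {ω | Y s ω = z}) * W := by
  induction I using Finset.induction_on_max with
  | empty => exact ⟨1, fun x s A _ => by simp⟩
  | insert a I ha ih =>
    obtain ⟨W, hW⟩ := ih
    rcases I.eq_empty_or_nonempty with rfl | hne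
    · refine ⟨NormedSpace.exp ((a : ℝ) • G) z (g a), fun x s A hA => ?_⟩
      simpa using hY.markov x s a A hA z (g a)
    -- The Markov property is used at `s + j`, the latest of the earlier times, where the state is
    -- already prescribed to be `g j`.
    · set j := I.max' hne with hj
      have hjI : j ∈ I := I.max'_mem hne
      refine ⟨W * NormedSpace.exp (((a - j : ℝ≥0) : ℝ) • G) (g j) (g a), fun x s A hA => ?_⟩
      have hA' : MeasurableSet[past Y (s + j)]
          (A ∩ {ω | Y s ω = z} ∩ {ω | ∀ i ∈ I, Y (s + i) ω = g i}) := by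
        refine MeasurableSet.inter (MeasurableSet.inter ?_ ?_) ?_
        · exact past_mono Y le_self_add _ hA
        · exact measurableSet_past Y le_self_add {z}
        · have : {ω | ∀ i ∈ I, Y (s + i) ω = g i} = ⋂ i ∈ I, {ω | Y (s + i) ω ∈ ({g i} : Set S)} := by
            ext ω
            simp
          rw [this]
          exact Finset.measurableSet_biInter _ fun i hi =>
            measurableSet_past Y (add_le_add_right (α := ℝ≥0) (I.le_max' i hi) s) _
      have := hY.markov x (s + j) (a - j) _ hA' (g j) (g a)
      rw [add_assoc, add_tsub_cancel_of_le (ha j hjI).le, Set.inter_assoc _ _ {ω | Y (s + j) ω = g j},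
        Set.inter_eq_left.2 (show {ω | ∀ i ∈ I, Y (s + i) ω = g i} ⊆ {ω | Y (s + j) ω = g j} from
          fun ω hω => hω j hjI), hW x s A hA] at this
      rw [← mul_assoc, ← this]
      congr 1
      ext ω
      simp only [Set.mem_inter_iff, Set.mem_ofPred_eq, Finset.forall_mem_insert]
      tauto

lemma IsCTMC.real_start (hY : IsCTMC G P Y) (x : S) : (P x).real {ω | Y 0 ω = x} = 1 := by
  simp [Measure.real, hY.start x]

lemma IsCTMC.ae_start (hY : IsCTMC G P Y) (x : S) : ∀ᵐ ω ∂(P x), Y 0 ω = x := by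
  have := hY.prob x
  exact (prob_compl_eq_zero_iff (hY.meas 0 (measurableSet_singleton x))).2 (hY.start x)

lemma IsCTMC.measurable_path (hY : IsCTMC G P Y) (s : ℝ≥0) :
    Measurable fun ω => shift s (Y · ω) :=
  measurable_pi_iff.2 fun t => hY.meas (s + t)

lemma shift_zero {α : Type*} (f : ℝ≥0 → α) : shift 0 f = f := by
  funext u
  simp [shift]

lemma IsCTMC.fdd_eq (hY : IsCTMC G P Y) (g : ℝ≥0 → S) (z : S) (I : Finset ℝ≥0) (x : S)
    (s : ℝ≥0) {A : Set Ω} (hA : MeasurableSet[past Y s] A) :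
    (P x).real (A ∩ {ω | Y s ω = z} ∩ {ω | ∀ i ∈ I, Y (s + i) ω = g i}) =
        (P x).real (A ∩ {ω | Y s ω = z}) * (P z).real {ω | ∀ i ∈ I, Y i ω = g i} := by
  obtain ⟨W, hW⟩ := hY.exists_fdd g z I
  rw [hW x s A hA]
  congr 1
  have := hY.prob z
  -- The constant is identified by specializing to start `z`, time `0` and the sure event.
  have h1 := hW z 0 Set.univ (@MeasurableSet.univ _ (past Y 0))
  simp only [Set.univ_inter, zero_add, hY.real_start, one_mul] at h1
  rw [← h1]
  refine measureReal_congr ?_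
  filter_upwards [hY.ae_start z] with ω hω
  exact propext ⟨fun h => h.2, fun h => ⟨hω, h⟩⟩

/-- The Markov property for the law of the whole future. -/
lemma IsCTMC.map_shift (hY : IsCTMC G P Y) (x z : S) (s : ℝ≥0) {A : Set Ω}
    (hA : MeasurableSet[past Y s] A) :
    ((P x).restrict (A ∩ {ω | Y s ω = z})).map (fun ω => shift s (Y · ω)) =
      P x (A ∩ {ω | Y s ω = z}) • (P z).map (fun ω => (Y · ω)) := by
  have := hY.prob x
  have := hY.prob z
  have hm0 : Measurable fun ω => (Y · ω) := measurable_pi_iff.2 hY.meas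
  set ν := P x (A ∩ {ω | Y s ω = z}) • (P z).map (fun ω => (Y · ω)) with hν
  have : IsFiniteMeasure ν := by
    have := Measure.isFiniteMeasure_map (P z) (fun ω => (Y · ω))
    exact Measure.smul_finite _ (measure_ne_top _ _)
  -- A finite measure on path space is determined by its finite-dimensional marginals, which are
  -- compared one finite configuration at a time.
  refine IsProjectiveLimit.unique (P := fun I : Finset ℝ≥0 => ν.map I.restrict) (fun I => ?_)
    fun I => rfl
  have hr : Measurable (I.restrict (π := fun _ : ℝ≥0 => S)) := Finset.measurable_restrict I
  beta_reduce
  rw [Measure.map_map hr (hY.measurable_path s), hν, Measure.map_smul, Measure.map_map hr hm0]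
  refine Measure.ext_of_singleton fun g => ?_
  rw [Measure.map_apply (hr.comp (hY.measurable_path s)) (measurableSet_singleton g),
    Measure.smul_apply, Measure.map_apply (hr.comp hm0) (measurableSet_singleton g),
    Measure.restrict_apply ((hr.comp (hY.measurable_path s)) (measurableSet_singleton g))]
  classical
  have hg : ∀ φ : ℝ≥0 → S, I.restrict φ = g ↔
      ∀ i ∈ I, φ i = if h : i ∈ I then g ⟨i, h⟩ else z := by
    intro φ
    constructor
    · rintro rfl i hi
      simp [hi]
    · intro h
      funext i
      have := h i i.2
      simpa using this
  have key := hY.fdd_eq (fun i => if h : i ∈ I then g ⟨i, h⟩ else z) z I x s hA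
  have h1 : (fun ω => shift s (Y · ω)) ⁻¹' (I.restrict ⁻¹' {g}) =
      {ω | ∀ i ∈ I, Y (s + i) ω = if h : i ∈ I then g ⟨i, h⟩ else z} := by
    ext ω
    exact hg _
  have h2 : (fun ω => (Y · ω)) ⁻¹' (I.restrict ⁻¹' {g}) =
      {ω | ∀ i ∈ I, Y i ω = if h : i ∈ I then g ⟨i, h⟩ else z} := by
    ext ω
    exact hg _
  rw [Set.preimage_comp, Set.preimage_comp, h1, h2, Set.inter_comm, smul_eq_mul]
  rw [Measure.real, Measure.real, Measure.real, ← ENNReal.toReal_mul] at key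
  exact (ENNReal.toReal_eq_toReal_iff' (measure_ne_top _ _)
    (ENNReal.mul_ne_top (measure_ne_top _ _) (measure_ne_top _ _))).1 key

lemma IsCTMC.setIntegral_shift (hY : IsCTMC G P Y) {F : (ℝ≥0 → S) → ℂ} (hF : IsPathMeasurable F)
    (x z : S) (s : ℝ≥0) {A : Set Ω} (hA : MeasurableSet[past Y s] A) :
    ∫ ω in A ∩ {ω | Y s ω = z}, F (shift s (Y · ω)) ∂(P x) =
      (P x).real (A ∩ {ω | Y s ω = z}) * ∫ ω, F (Y · ω) ∂(P z) := by
  obtain ⟨Φ, hΦ, hFΦ⟩ := hF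
  have hm0 : Measurable fun ω => (Y · ω) := measurable_pi_iff.2 hY.meas
  have h1 : ∀ ω, F (shift s (Y · ω)) = Φ (shift s (Y · ω)) := fun ω =>
    hFΦ _ ((hY.isRightConst ω).shift s)
  have h2 : ∀ ω, F (Y · ω) = Φ (Y · ω) := fun ω => hFΦ _ (hY.isRightConst ω)
  simp_rw [h1, h2]
  rw [← integral_map (hY.measurable_path s).aemeasurable hΦ.aestronglyMeasurable,
    ← integral_map hm0.aemeasurable hΦ.aestronglyMeasurable, hY.map_shift x z s hA,
    integral_smul_measure]
  exact Complex.real_smul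

lemma IsCTMC.measurable_comp_shift (hY : IsCTMC G P Y) {F : (ℝ≥0 → S) → ℂ}
    (hF : IsPathMeasurable F) (s : ℝ≥0) : Measurable fun ω => F (shift s (Y · ω)) := by
  obtain ⟨Φ, hΦ, hFΦ⟩ := hF
  simp_rw [fun ω => hFΦ _ ((hY.isRightConst ω).shift s)]
  exact hΦ.comp (hY.measurable_path s)

end Markov

/-! ### Limits of powers and geometric sums in a Banach algebra -/

section BanachAlgebra

variable {𝔸 : Type*} [NormedRing 𝔸]

lemma norm_pow_mul_le {a : 𝔸} {c : ℝ} (ha : ‖a‖ ≤ c) (x : 𝔸) (n : ℕ) :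
    ‖a ^ n * x‖ ≤ c ^ n * ‖x‖ := by
  have hc : 0 ≤ c := (norm_nonneg a).trans ha
  induction n with
  | zero => simp
  | succ n ih =>
    rw [pow_succ', mul_assoc, pow_succ', mul_assoc]
    exact (norm_mul_le _ _).trans (mul_le_mul ha ih (norm_nonneg _) hc)

lemma norm_pow_sub_pow_le {a b : 𝔸} {c : ℝ} (hc : 1 ≤ c) (ha : ‖a‖ ≤ c) (hb : ‖b‖ ≤ c) (n : ℕ) :
    ‖a ^ n - b ^ n‖ ≤ c ^ n * (n * ‖a - b‖) := by
  have hc0 : 0 ≤ c := zero_le_one.trans hc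
  induction n with
  | zero => simp
  | succ n ih =>
    have h1 : a ^ (n + 1) - b ^ (n + 1) = a ^ n * (a - b) + (a ^ n - b ^ n) * b := by
      rw [pow_succ, pow_succ]
      noncomm_ring
    rw [h1]
    have h2 : c ^ n ≤ c ^ (n + 1) := pow_le_pow_right₀ hc n.le_succ
    calc ‖a ^ n * (a - b) + (a ^ n - b ^ n) * b‖
        ≤ c ^ n * ‖a - b‖ + c ^ n * (n * ‖a - b‖) * c := by
          refine (norm_add_le _ _).trans (add_le_add (norm_pow_mul_le ha _ n) ?_)
          exact (norm_mul_le _ _).trans (mul_le_mul ih hb (norm_nonneg _) (by positivity))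
      _ ≤ c ^ (n + 1) * ‖a - b‖ + c ^ n * (n * ‖a - b‖) * c := by gcongr
      _ = c ^ (n + 1) * ((n + 1 : ℕ) * ‖a - b‖) := by push_cast; ring

/-- The killed step `M` is close to `p`, not to `1`, so its powers do not directly have an
exponential limit. Adding `1 - p` gives an element close to `1`, and one remaining factor `M`
absorbs the change. -/
lemma idem_add_pow_mul {p M : 𝔸} (hM : p * M = M) (n : ℕ) :
    (1 - p + M) ^ n * M = M ^ (n + 1) := by
  induction n with
  | zero => simp
  | succ n ih =>
    have h1 : (1 - p + M) * M = M * M := by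
      rw [add_mul, sub_mul, one_mul, hM, sub_self, zero_add]
    rw [pow_succ, mul_assoc, h1, ← mul_assoc, ih, ← pow_succ]

variable [NormedAlgebra ℂ 𝔸]

lemma norm_le_exp_of_smul_sub_one [NormOneClass 𝔸] {a : 𝔸} {C : ℝ} {n : ℕ} (hn : n ≠ 0)
    (h : ‖(n : ℂ) • (a - 1)‖ ≤ C) : ‖a‖ ≤ Real.exp (C / n) := by
  have hn' : (0 : ℝ) < n := by positivity
  rw [norm_smul, Complex.norm_natCast] at h
  have h1 : ‖a - 1‖ ≤ C / n := by rwa [le_div_iff₀' hn']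
  have h2 : ‖a‖ ≤ ‖a - 1‖ + 1 := by
    simpa using norm_add_le (a - 1) (1 : 𝔸)
  linarith [Real.add_one_le_exp (C / n)]

/-- The derivative at `0` of `t ↦ exp (t x)`, along sequences. -/
lemma tendsto_inv_smul_exp_sub_one [CompleteSpace 𝔸] (x : 𝔸) {δ : ℕ → ℂ}
    (hδ : Tendsto δ atTop (𝓝[≠] 0)) :
    Tendsto (fun n => (δ n)⁻¹ • (NormedSpace.exp (δ n • x) - 1)) atTop (𝓝 x) := by
  have h := (hasDerivAt_exp_smul_const x (0 : ℂ)).tendsto_slope_zero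
  simp only [zero_add, zero_smul, NormedSpace.exp_zero, one_mul] at h
  exact h.comp hδ

lemma tendsto_inv_natCast : Tendsto (fun n : ℕ => ((n : ℂ))⁻¹) atTop (𝓝[≠] 0) := by
  refine tendsto_nhdsWithin_of_tendsto_nhds_of_eventually_within _ tendsto_inv_atTop_nhds_zero_nat ?_
  filter_upwards [eventually_ne_atTop 0] with n hn
  simpa using hn

/-- The powers are compared with those of `exp (x / n)`, whose `n`-th power is exactly `exp x`. Both
bases have norm at most `exp ((‖x‖ + 1) / n)` eventually, so the telescoping bound reduces the
difference of powers to the difference of the rescaled increments, which tends to `0`. -/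
lemma tendsto_pow_exp [CompleteSpace 𝔸] [NormOneClass 𝔸] {a : ℕ → 𝔸} {x : 𝔸}
    (h : Tendsto (fun n : ℕ => (n : ℂ) • (a n - 1)) atTop (𝓝 x)) :
    Tendsto (fun n => a n ^ n) atTop (𝓝 (NormedSpace.exp x)) := by
  set b : ℕ → 𝔸 := fun n => NormedSpace.exp ((n : ℂ)⁻¹ • x) with hb
  have hb' : Tendsto (fun n : ℕ => (n : ℂ) • (b n - 1)) atTop (𝓝 x) := by
    simpa using tendsto_inv_smul_exp_sub_one x tendsto_inv_natCast
  have hbn : ∀ᶠ n in atTop, b n ^ n = NormedSpace.exp x := by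
    filter_upwards [eventually_ne_atTop 0] with n hn
    let : NormedAlgebra ℚ 𝔸 := NormedAlgebra.restrictScalars ℚ ℂ 𝔸
    rw [hb, ← NormedSpace.exp_nsmul, ← Nat.cast_smul_eq_nsmul ℂ, smul_smul,
      mul_inv_cancel₀ (by exact_mod_cast hn), one_smul]
  have hC : ∀ᶠ n : ℕ in atTop, ‖(n : ℂ) • (a n - 1)‖ ≤ ‖x‖ + 1 :=
    (h.norm.eventually_lt_const (lt_add_one _)).mono fun n hn => hn.le
  have hC' : ∀ᶠ n : ℕ in atTop, ‖(n : ℂ) • (b n - 1)‖ ≤ ‖x‖ + 1 :=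
    (hb'.norm.eventually_lt_const (lt_add_one _)).mono fun n hn => hn.le
  have hdiff : Tendsto (fun n : ℕ => Real.exp (‖x‖ + 1) * ‖(n : ℂ) • (a n - 1) - (n : ℂ) • (b n - 1)‖)
      atTop (𝓝 0) := by
    simpa using ((h.sub hb').norm.const_mul (Real.exp (‖x‖ + 1)))
  have hsub : Tendsto (fun n => a n ^ n - b n ^ n) atTop (𝓝 0) := by
    refine squeeze_zero_norm' ?_ hdiff
    filter_upwards [hC, hC', eventually_ne_atTop 0] with n h1 h2 hn
    have h3 := norm_pow_sub_pow_le (Real.one_le_exp (by positivity))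
      (norm_le_exp_of_smul_sub_one hn h1) (norm_le_exp_of_smul_sub_one hn h2) n
    rw [← Real.exp_nat_mul, mul_div_cancel₀ _ (by exact_mod_cast hn)] at h3
    rw [← smul_sub, sub_sub_sub_cancel_right, norm_smul, Complex.norm_natCast]
    exact h3
  have := hsub.add (tendsto_const_nhds (x := NormedSpace.exp x))
  rw [zero_add] at this
  refine this.congr' ?_
  filter_upwards [hbn] with n hn
  rw [hn, sub_add_cancel]

/-- The mesh of the grid with `n + 1` steps on `[0, K]`, as a complex number. -/
def mesh (K : ℝ≥0) (n : ℕ) : ℂ := ((K / (n + 1) : ℝ≥0) : ℝ)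

lemma mesh_eq (K : ℝ≥0) (n : ℕ) : mesh K n = ((K : ℝ) : ℂ) / (n + 1) := by
  simp [mesh]

lemma mesh_ne_zero {K : ℝ≥0} (hK : 0 < K) (n : ℕ) : mesh K n ≠ 0 := by
  have : K / ((n : ℝ≥0) + 1) ≠ 0 := by positivity
  unfold mesh
  exact_mod_cast this

lemma tendsto_mesh {K : ℝ≥0} (hK : 0 < K) : Tendsto (mesh K) atTop (𝓝[≠] 0) := by
  refine tendsto_nhdsWithin_of_tendsto_nhds_of_eventually_within _ ?_
    (Eventually.of_forall (mesh_ne_zero hK))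
  have h1 : Tendsto (fun t : ℝ≥0 => ((t : ℝ) : ℂ)) (𝓝 0) (𝓝 0) := by
    have : Continuous (fun t : ℝ≥0 => ((t : ℝ) : ℂ)) := by fun_prop
    simpa using this.tendsto 0
  exact h1.comp (tendsto_gridPt_one K)

lemma tendsto_natCast_mul_mesh (K : ℝ≥0) :
    Tendsto (fun n : ℕ => (n : ℂ) * mesh K n) atTop (𝓝 ((K : ℝ) : ℂ)) := by
  have h := (tendsto_natCast_div_add_atTop (1 : ℂ)).const_mul ((K : ℝ) : ℂ)
  rw [mul_one] at h
  refine h.congr fun n => ?_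
  rw [mesh_eq]
  ring

variable [CompleteSpace 𝔸] {p : 𝔸}

/-- The semigroup killed outside the range of `p`, as a limit of skeletons. -/
lemma tendsto_skeleton_pow [NormOneClass 𝔸] (hp : p * p = p) (g : 𝔸) {K : ℝ≥0} (hK : 0 < K) :
    Tendsto (fun n => (p * NormedSpace.exp (mesh K n • g)) ^ (n + 1)) atTop
      (𝓝 (NormedSpace.exp (((K : ℝ) : ℂ) • (p * g)) * p)) := by
  set M : ℕ → 𝔸 := fun n => p * NormedSpace.exp (mesh K n • g) with hM
  have hpM : ∀ n, p * M n = M n := fun n => by rw [hM, ← mul_assoc, hp]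
  have hder := tendsto_inv_smul_exp_sub_one g (tendsto_mesh hK)
  have h1 : Tendsto (fun n : ℕ => (n : ℂ) • (1 - p + M n - 1)) atTop
      (𝓝 (((K : ℝ) : ℂ) • (p * g))) := by
    refine ((tendsto_natCast_mul_mesh K).smul (hder.const_mul p)).congr fun n => ?_
    rw [mul_smul_comm, smul_smul, mul_assoc, mul_inv_cancel₀ (mesh_ne_zero hK n), mul_one]
    congr 1
    rw [hM]
    noncomm_ring
  have h2 : Tendsto M atTop (𝓝 p) := by
    have h3 : Tendsto (fun n => mesh K n • g) atTop (𝓝 0) := by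
      simpa using ((tendsto_mesh hK).mono_right nhdsWithin_le_nhds).smul_const g
    let : NormedAlgebra ℚ 𝔸 := NormedAlgebra.restrictScalars ℚ ℂ 𝔸
    have h4 := ((NormedSpace.exp_continuous (𝔸 := 𝔸)).tendsto 0).comp h3
    rw [NormedSpace.exp_zero] at h4
    simpa using h4.const_mul p
  refine ((tendsto_pow_exp h1).mul h2).congr fun n => ?_
  exact idem_add_pow_mul (hpM n) n

/-- The geometric sums of the discounted skeleton. -/
lemma tendsto_skeleton_geom_sum [NormOneClass 𝔸] (hp : p * p = p) (g : 𝔸) (q : ℂ) {K : ℝ≥0}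
    (hK : 0 < K) {R : 𝔸ˣ} (hR : (R : 𝔸) = p * (q • 1 - g) + (1 - p)) :
    Tendsto (fun n => (∑ k ∈ Finset.range (n + 1), (Complex.exp (-q * mesh K n) •
        (p * NormedSpace.exp (mesh K n • g))) ^ k) * (1 - p)) atTop
      (𝓝 ((1 - Complex.exp (-q * ((K : ℝ) : ℂ)) •
        (NormedSpace.exp (((K : ℝ) : ℂ) • (p * g)) * p)) * ↑R⁻¹ * (1 - p))) := by
  set e : ℕ → 𝔸 := fun n => NormedSpace.exp (mesh K n • g) with he
  set c : ℕ → ℂ := fun n => Complex.exp (-q * mesh K n) with hc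
  have hmesh0 : Tendsto (mesh K) atTop (𝓝 0) := (tendsto_mesh hK).mono_right nhdsWithin_le_nhds
  have hc1 : Tendsto c atTop (𝓝 1) := by
    have : Continuous fun z : ℂ => Complex.exp (-q * z) := by fun_prop
    exact (this.tendsto' 0 1 (by simp)).comp hmesh0
  have hcd : Tendsto (fun n => (mesh K n)⁻¹ * (c n - 1)) atTop (𝓝 (-q)) := by
    have h := tendsto_inv_smul_exp_sub_one (-q) (tendsto_mesh hK)
    refine h.congr fun n => ?_
    rw [← Complex.exp_eq_exp_ℂ, smul_eq_mul, smul_eq_mul, mul_comm (mesh K n) (-q)]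
  have hed := tendsto_inv_smul_exp_sub_one g (tendsto_mesh hK)
  set Rn : ℕ → 𝔸 := fun n => p * ((mesh K n)⁻¹ • (1 - c n • e n)) + (1 - p) with hRn
  have hRlim : Tendsto Rn atTop (𝓝 R) := by
    rw [hR]
    refine Tendsto.add_const _ (Tendsto.const_mul _ ?_)
    have h := ((hc1.smul hed).neg).sub (hcd.smul_const (1 : 𝔸))
    have hlim : -((1 : ℂ) • g) - (-q) • (1 : 𝔸) = q • 1 - g := by
      rw [one_smul, neg_smul]
      abel
    rw [hlim] at h
    refine h.congr fun n => ?_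
    simp only [smul_sub, smul_smul, mul_sub, mul_one, sub_smul]
    rw [mul_comm (c n) (mesh K n)⁻¹]
    abel
  have hpow : Tendsto (fun n => (c n • (p * e n)) ^ (n + 1)) atTop
      (𝓝 (Complex.exp (-q * ((K : ℝ) : ℂ)) • (NormedSpace.exp (((K : ℝ) : ℂ) • (p * g)) * p))) := by
    refine ((tendsto_skeleton_pow hp g hK).const_smul _).congr fun n => ?_
    have h1 : ((n + 1 : ℕ) : ℂ) * (-q * mesh K n) = -q * ((K : ℝ) : ℂ) := by
      have : (n : ℂ) + 1 ≠ 0 := by exact_mod_cast n.succ_ne_zero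
      rw [mesh_eq]
      push_cast
      field_simp
    rw [smul_pow, hc, ← Complex.exp_nat_mul, h1]
  have hinv : Tendsto (fun n => Ring.inverse (Rn n)) atTop (𝓝 (↑R⁻¹)) := by
    rw [← Ring.inverse_unit]
    exact (NormedRing.inverse_continuousAt R).tendsto.comp hRlim
  have hunit : ∀ᶠ n in atTop, IsUnit (Rn n) := hRlim.eventually (Units.nhds R)
  have hlim := ((tendsto_const_nhds (x := (1 : 𝔸)).sub hpow).mul hinv).mul_const (1 - p)
  refine hlim.congr' ?_
  filter_upwards [hunit] with n hn
  -- The factor `1 - c • (p * e)` degenerates as the mesh shrinks. The scalar mesh is split off on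
  -- the range of `p`, leaving `Rn`, which converges to an invertible limit; the degenerate factor
  -- disappears against `1 - p` by `hfac2`.
  have hfac : 1 - c n • (p * e n) = (mesh K n • p + (1 - p)) * Rn n := by
    have h1 : p * (1 - p) = 0 := by rw [mul_sub, mul_one, hp, sub_self]
    have h2 : (1 - p) * p = 0 := by rw [sub_mul, one_mul, hp, sub_self]
    have h3 : (1 - p) * (1 - p) = 1 - p := by rw [mul_sub, h2, mul_one, sub_zero]
    rw [hRn, add_mul, mul_add, mul_add, ← mul_assoc, ← mul_assoc, h2, h3, smul_mul_assoc, hp,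
      smul_mul_assoc, smul_mul_assoc, h1, smul_zero, zero_mul, add_zero, zero_add, mul_smul_comm,
      smul_smul, mul_inv_cancel₀ (mesh_ne_zero hK n), one_smul, mul_sub, mul_one, mul_smul_comm]
    abel
  have hfac2 : (mesh K n • p + (1 - p)) * (1 - p) = 1 - p := by
    have h1 : p * (1 - p) = 0 := by rw [mul_sub, mul_one, hp, sub_self]
    have h2 : (1 - p) * p = 0 := by rw [sub_mul, one_mul, hp, sub_self]
    rw [add_mul, smul_mul_assoc, h1, smul_zero, zero_add, mul_sub, h2, mul_one, sub_zero]
  rw [← geom_sum_mul_neg, hfac, ← mul_assoc, mul_assoc _ (Rn n), Ring.mul_inverse_cancel _ hn,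
    mul_one, mul_assoc, hfac2]

end BanachAlgebra

/-! ### The matrices of the killed chain -/

section Matrices

variable {S : Finset ℝ} (G : Matrix S S ℝ) (b : S → Prop) [DecidablePred b]

/-- The diagonal matrix of the indicator of `b`. -/
def indMat : Matrix S S ℂ := Matrix.diagonal fun x => if b x then 1 else 0

lemma indMat_mul_self : indMat b * indMat b = indMat b := by
  rw [indMat, Matrix.diagonal_mul_diagonal]
  congr 1
  funext x
  split_ifs <;> simp

lemma one_sub_indMat : 1 - indMat b = indMat fun x => ¬ b x := by
  rw [indMat, indMat, ← Matrix.diagonal_one, Matrix.diagonal_sub]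
  congr 1
  funext x
  by_cases h : b x <;> simp [h]

lemma indMat_mul_apply (A : Matrix S S ℂ) (x y : S) :
    (indMat b * A) x y = if b x then A x y else 0 := by
  simp [indMat, Matrix.diagonal_mul]

lemma mul_indMat_apply (A : Matrix S S ℂ) (x y : S) :
    (A * indMat b) x y = if b y then A x y else 0 := by
  simp [indMat, Matrix.mul_diagonal]

/-- The transition matrix of the skeleton with `n + 1` steps on `[0, K]`, killed outside `b`. -/
def skeleton (K : ℝ≥0) (n : ℕ) : Matrix S S ℂ := indMat b * NormedSpace.exp (mesh K n • cx G)

/-- The semigroup at time `K` of the chain killed outside `b`. -/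
def killed (K : ℝ≥0) : Matrix S S ℂ :=
  NormedSpace.exp (((K : ℝ) : ℂ) • (indMat b * cx G)) * indMat b

/-- `q I - I G + (1 - I)` with `I` the indicator of `b`. -/
def exitResolv (q : ℂ) : Matrix S S ℂ := indMat b * (q • 1 - cx G) + (1 - indMat b)

/-- The discounted exit distribution from `b`. -/
def exitMat (q : ℂ) : Matrix S S ℂ := (exitResolv G b q)⁻¹ * (1 - indMat b)

/-- The discounted exit distribution from `b` before time `K`. -/
def exitMatBefore (q : ℂ) (K : ℝ≥0) : Matrix S S ℂ :=
  exitMat G b q - Complex.exp (-q * ((K : ℝ) : ℂ)) • (killed G b K * exitMat G b q)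

variable {G b}

/-- Strict diagonal dominance by rows. In a row of `b` the off-diagonal moduli add up to `-G x x`,
while the diagonal entry has real part `q.re - G x x`; the other rows are those of the identity. -/
lemma IsRateMatrix.isUnit_exitResolv (hG : IsRateMatrix G) {q : ℂ} (hq : 0 < q.re) :
    IsUnit (exitResolv G b q) := by
  rw [Matrix.isUnit_iff_isUnit_det, isUnit_iff_ne_zero]
  refine det_ne_zero_of_sum_row_lt_diag fun x => ?_
  have hentry : ∀ y, exitResolv G b q x y =
      if b x then (if x = y then q else 0) - (G x y : ℂ) else if x = y then 1 else 0 := by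
    intro y
    rw [exitResolv, Matrix.add_apply, indMat_mul_apply, one_sub_indMat]
    by_cases hb : b x <;> simp [hb, indMat, cx, Matrix.diagonal_apply, Matrix.one_apply]
  by_cases hb : b x
  · simp only [hentry, if_pos hb]
    have h1 : ∑ y ∈ Finset.univ.erase x, ‖(if x = y then q else 0) - (G x y : ℂ)‖ = - G x x := by
      rw [hG.diag x, neg_neg]
      have : Finset.univ.filter (fun y => y ≠ x) = Finset.univ.erase x := by
        ext y
        simp
      rw [this]
      refine Finset.sum_congr rfl fun y hy => ?_
      have hxy : x ≠ y := (Finset.ne_of_mem_erase hy).symm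
      rw [if_neg hxy, zero_sub, norm_neg, Complex.norm_real, Real.norm_of_nonneg (hG.nonneg x y hxy)]
    rw [h1]
    simp only [if_true]
    calc -G x x < (q - (G x x : ℂ)).re := by simp [hq]
      _ ≤ _ := Complex.re_le_norm _
  · simp only [hentry, if_neg hb, if_true, norm_one]
    rw [Finset.sum_eq_zero fun y hy => by simp [(Finset.ne_of_mem_erase hy).symm]]
    exact one_pos

open scoped Matrix.Norms.Operator in
lemma ofReal_exp_smul (t : ℝ) (x y : S) :
    ((NormedSpace.exp (t • G) x y : ℝ) : ℂ) = NormedSpace.exp ((t : ℂ) • cx G) x y := by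
  have hcont : Continuous (Complex.ofRealHom.mapMatrix : Matrix S S ℝ →+* Matrix S S ℂ) := by
    refine continuous_pi fun i => continuous_pi fun j => ?_
    exact Complex.continuous_ofReal.comp ((continuous_apply j).comp (continuous_apply i))
  let : NormedAlgebra ℚ (Matrix S S ℝ) := NormedAlgebra.restrictScalars ℚ ℝ _
  let : NormedAlgebra ℚ (Matrix S S ℂ) := NormedAlgebra.restrictScalars ℚ ℂ _
  have h := NormedSpace.map_exp (Complex.ofRealHom.mapMatrix : Matrix S S ℝ →+* Matrix S S ℂ)
    hcont (t • G)
  have h2 : (Complex.ofRealHom.mapMatrix (t • G) : Matrix S S ℂ) = (t : ℂ) • cx G := by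
    ext i j
    simp [cx]
  rw [h2] at h
  exact congrFun (congrFun h x) y

open scoped Matrix.Norms.Operator in
lemma tendsto_skeleton_pow_apply {K : ℝ≥0} (hK : 0 < K) (x y : S) :
    Tendsto (fun n => (skeleton G b K n ^ (n + 1)) x y) atTop (𝓝 (killed G b K x y)) := by
  have : Nonempty S := ⟨x⟩
  have h := tendsto_skeleton_pow (indMat_mul_self b) (cx G) hK
  exact ((continuous_apply_apply x y).tendsto _).comp h

open scoped Matrix.Norms.Operator in
lemma IsRateMatrix.tendsto_skeleton_geom_sum_apply (hG : IsRateMatrix G) {q : ℂ} (hq : 0 < q.re)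
    {K : ℝ≥0} (hK : 0 < K) (x y : S) :
    Tendsto (fun n => ((∑ k ∈ Finset.range (n + 1), (Complex.exp (-q * mesh K n) •
      skeleton G b K n) ^ k) * (1 - indMat b)) x y) atTop (𝓝 (exitMatBefore G b q K x y)) := by
  have : Nonempty S := ⟨x⟩
  have h := tendsto_skeleton_geom_sum (indMat_mul_self b) (cx G) q hK
    (R := (hG.isUnit_exitResolv (b := b) hq).unit) rfl
  have h2 : exitMatBefore G b q K = (1 - Complex.exp (-q * ((K : ℝ) : ℂ)) •
      (NormedSpace.exp (((K : ℝ) : ℂ) • (indMat b * cx G)) * indMat b)) *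
      ((hG.isUnit_exitResolv (b := b) hq).unit⁻¹ : (Matrix S S ℂ)ˣ).val * (1 - indMat b) := by
    rw [Matrix.coe_units_inv, IsUnit.unit_spec, mul_assoc, sub_mul, one_mul, smul_mul_assoc]
    rfl
  rw [h2]
  exact ((continuous_apply_apply x y).tendsto _).comp h

end Matrices

/-! ### The chain observed along a grid -/

section Grid

variable {S : Finset ℝ} {Ω : Type*}

/-- The path has stayed in `b` at the first `k` grid points. -/
def gridStay (Y : ℝ≥0 → Ω → S) (b : S → Prop) (K : ℝ≥0) (n k : ℕ) : Set Ω :=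
  {ω | ∀ j < k, b (Y (gridPt K n j) ω)}

lemma gridPt_succ (K : ℝ≥0) (n k : ℕ) : gridPt K n (k + 1) = gridPt K n k + K / (n + 1) := by
  unfold gridPt
  push_cast
  ring

lemma gridPt_mono (K : ℝ≥0) (n : ℕ) : Monotone (gridPt K n) :=
  monotone_nat_of_le_succ fun k => by
    rw [gridPt_succ]
    exact le_self_add

lemma measurableSet_gridStay (Y : ℝ≥0 → Ω → S) (b : S → Prop) (K : ℝ≥0) (n k : ℕ) :
    MeasurableSet[past Y (gridPt K n k)] (gridStay Y b K n k) := by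
  have : gridStay Y b K n k = ⋂ j ∈ Finset.range k, {ω | Y (gridPt K n j) ω ∈ {z | b z}} := by
    ext ω
    simp [gridStay]
  rw [this]
  exact Finset.measurableSet_biInter _ fun j hj =>
    measurableSet_past Y (gridPt_mono K n (Finset.mem_range.1 hj).le) _

lemma gridExit_eq_sum (Y : ℝ≥0 → Ω → S) (b : S → Prop) (K : ℝ≥0) (n : ℕ)
    (c : Ω → ℝ≥0 → ℂ) (ω : Ω) :
    gridExit K b n (c ω) (Y · ω) = ∑ k ∈ Finset.range (n + 1),
      (gridStay Y b K n k ∩ {ω | ¬ b (Y (gridPt K n k) ω)}).indicator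
        (fun ω => c ω (gridPt K n k)) ω := by
  classical
  unfold gridExit
  refine Finset.sum_congr rfl fun k _ => ?_
  rw [Set.indicator_apply]
  exact if_congr Iff.rfl rfl rfl

variable [MeasurableSpace Ω] {G : Matrix S S ℝ} {P : S → Measure Ω} {Y : ℝ≥0 → Ω → S} {b : S → Prop}
  {F : (ℝ≥0 → S) → ℂ}

lemma setIntegral_eq_sum_state (hY : IsCTMC G P Y) (x : S) (s : ℝ≥0) {A : Set Ω}
    (hA : MeasurableSet A) {φ : Ω → ℂ} (hφ : Integrable φ (P x)) :
    ∫ ω in A, φ ω ∂(P x) = ∑ z, ∫ ω in A ∩ {ω | Y s ω = z}, φ ω ∂(P x) := by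
  rw [← integral_iUnion_fintype]
  · congr 2
    ext ω
    simp
  · exact fun z => hA.inter (hY.meas s (measurableSet_singleton z))
  · intro z w hzw
    refine Set.disjoint_left.2 fun ω h1 h2 => hzw ?_
    exact h1.2.symm.trans h2.2
  · exact fun z => hφ.integrableOn

lemma IsCTMC.measurableSet_gridStay_exit (hY : IsCTMC G P Y) (K : ℝ≥0) (n k : ℕ) :
    MeasurableSet (gridStay Y b K n k ∩ {ω | ¬ b (Y (gridPt K n k) ω)}) :=
  (hY.past_le _ _ (measurableSet_gridStay Y b K n k)).inter
    (hY.meas _ (Set.toFinite {z | ¬ b z}).measurableSet)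

lemma IsCTMC.measurable_gridExit (hY : IsCTMC G P Y) (hF : IsPathMeasurable F) (q : ℂ) (K : ℝ≥0)
    (n : ℕ) : Measurable fun ω =>
      gridExit K b n (fun t => expNeg q t * F (shift t (Y · ω))) (Y · ω) := by
  simp_rw [gridExit_eq_sum Y b K n (fun ω t => expNeg q t * F (shift t (Y · ω)))]
  refine Finset.measurable_fun_sum _ fun k _ => Measurable.indicator ?_
    (hY.measurableSet_gridStay_exit K n k)
  exact (hY.measurable_comp_shift hF _).const_mul _

/-- An exit before `K` persists for a short time by right continuity, hence is seen by every
sufficiently fine grid. -/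
lemma IsCTMC.eventually_mem_gridStay_iff (hY : IsCTMC G P Y) {K : ℝ≥0} (hK : 0 < K) (ω : Ω) :
    ∀ᶠ n in atTop, ω ∈ gridStay Y b K n (n + 1) ↔ ω ∈ {ω | ∀ t < K, b (Y t ω)} := by
  by_cases h : ∀ t < K, b (Y t ω)
  · refine Eventually.of_forall fun n => ⟨fun _ => h, fun _ j hj => h _ ?_⟩
    conv_rhs => rw [← gridPt_self K n]
    exact (gridPt_lt_iff hK).2 hj
  · have h' := h
    push Not at h'
    obtain ⟨T, hTK, hT⟩ := h'
    filter_upwards [eventually_exists_grid_exit hK (hY.isRightConst ω) hT hTK] with n hn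
    obtain ⟨j, hj, hbj⟩ := hn
    exact ⟨fun h2 => absurd (h2 j hj) hbj, fun h2 => absurd h2 h⟩

lemma IsCTMC.measurableSet_stay (hY : IsCTMC G P Y) {K : ℝ≥0} (hK : 0 < K) :
    MeasurableSet {ω | ∀ t < K, b (Y t ω)} :=
  measurableSet_of_tendsto_indicator atTop
    (fun n => hY.past_le _ _ (measurableSet_gridStay Y b K n (n + 1)))
    (hY.eventually_mem_gridStay_iff hK)

variable [DecidablePred b]

/-- One step of the skeleton tests `b` at the current grid point and then moves, so the state at the
`k`-th point is itself untested. The induction is the Markov property at the preceding grid point.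
-/
lemma IsCTMC.real_gridStay (hY : IsCTMC G P Y) (K : ℝ≥0) (n : ℕ) (x : S) (k : ℕ) (z : S) :
    (((P x).real (gridStay Y b K n k ∩ {ω | Y (gridPt K n k) ω = z}) : ℝ) : ℂ) =
      (skeleton G b K n ^ k) x z := by
  have := hY.prob x
  induction k generalizing z with
  | zero =>
    have h0 : gridStay Y b K n 0 = Set.univ := by simp [gridStay]
    rw [h0, Set.univ_inter, pow_zero, Matrix.one_apply]
    have h1 : gridPt K n 0 = 0 := by simp [gridPt]
    rw [h1]
    split_ifs with h
    · rw [← h, hY.real_start]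
      simp
    · have : (P x).real {ω | Y 0 ω = z} = 0 := by
        rw [measureReal_eq_zero_iff, ← compl_mem_ae_iff]
        filter_upwards [hY.ae_start x] with ω hω hz
        exact h (hω.symm.trans hz)
      simp [this]
  | succ k ih =>
    have hmeas : MeasurableSet (gridStay Y b K n (k + 1) ∩ {ω | Y (gridPt K n (k + 1)) ω = z}) :=
      (hY.past_le _ _ (measurableSet_gridStay Y b K n (k + 1))).inter
        (hY.meas _ (measurableSet_singleton z))
    have h1 := setIntegral_eq_sum_state hY x (gridPt K n k) hmeas (integrable_const (1 : ℂ))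
    simp only [setIntegral_const, Complex.real_smul, mul_one] at h1
    rw [h1, pow_succ, Matrix.mul_apply]
    refine Finset.sum_congr rfl fun w _ => ?_
    rw [← ih w, skeleton, indMat_mul_apply]
    split_ifs with hb
    · have hm := hY.markov x (gridPt K n k) (K / (n + 1)) _
        (measurableSet_gridStay Y b K n k) w z
      have he := ofReal_exp_smul (G := G) ((K / (n + 1) : ℝ≥0) : ℝ) w z
      rw [mesh, ← he, ← Complex.ofReal_mul, ← hm, ← gridPt_succ]
      congr 2
      ext ω
      simp only [gridStay, Set.mem_inter_iff, Set.mem_ofPred_eq, Nat.lt_succ_iff_lt_or_eq]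
      constructor
      · rintro ⟨⟨h2, h3⟩, h4⟩
        exact ⟨⟨fun j hj => h2 j (Or.inl hj), h4⟩, h3⟩
      · rintro ⟨⟨h2, h4⟩, h3⟩
        refine ⟨⟨fun j hj => ?_, h3⟩, h4⟩
        rcases hj with hj | rfl
        · exact h2 j hj
        · rwa [h4]
    · have : gridStay Y b K n (k + 1) ∩ {ω | Y (gridPt K n (k + 1)) ω = z} ∩
          {ω | Y (gridPt K n k) ω = w} = ∅ := by
        refine Set.eq_empty_of_forall_notMem fun ω hω => hb ?_
        have h2 := hω.1.1 k k.lt_succ_self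
        have h3 : Y (gridPt K n k) ω = w := hω.2
        rwa [h3] at h2
      simp [this]

/-- The law of the killed chain: `P_x(Y_t ∈ b for t < K, Y_K = y)`. -/
lemma IsCTMC.real_stay (hY : IsCTMC G P Y) {K : ℝ≥0} (hK : 0 < K) (x y : S) :
    (((P x).real {ω | (∀ t < K, b (Y t ω)) ∧ Y K ω = y} : ℝ) : ℂ) = killed G b K x y := by
  have := hY.prob x
  refine tendsto_nhds_unique ?_ (tendsto_skeleton_pow_apply (G := G) (b := b) hK x y)
  simp_rw [← hY.real_gridStay K _ x _ y, gridPt_self]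
  refine (Complex.continuous_ofReal.tendsto _).comp ?_
  refine (ENNReal.tendsto_toReal (measure_ne_top _ _)).comp ?_
  refine tendsto_measure_of_tendsto_indicator_of_isFiniteMeasure _ _ (fun n => ?_) fun ω => ?_
  · exact (hY.past_le _ _ (measurableSet_gridStay Y b K n (n + 1))).inter
      (hY.meas _ (measurableSet_singleton y))
  · filter_upwards [hY.eventually_mem_gridStay_iff hK ω] with n hn
    exact and_congr_left fun _ => hn

/-- The entries are probabilities. This gives a bound uniform in `K`, which is what the limit of
infinite horizon needs. -/
lemma IsCTMC.norm_killed_le_one (hY : IsCTMC G P Y) {K : ℝ≥0} (hK : 0 < K) (x y : S) :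
    ‖killed G b K x y‖ ≤ 1 := by
  have := hY.prob x
  rw [← hY.real_stay hK, Complex.norm_real, Real.norm_of_nonneg measureReal_nonneg]
  exact measureReal_le_one

lemma expNeg_gridPt (q : ℂ) (K : ℝ≥0) (n k : ℕ) :
    expNeg q (gridPt K n k) = Complex.exp (-q * mesh K n) ^ k := by
  rw [expNeg_coe, ← Complex.exp_nat_mul, mesh, gridPt]
  congr 1
  push_cast
  ring

lemma IsCTMC.integrable_restart (hY : IsCTMC G P Y) (hF : IsPathMeasurable F)
    (hF1 : ∀ f, ‖F f‖ ≤ 1) (x : S) (a : ℂ) (s : ℝ≥0) :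
    Integrable (fun ω => a * F (shift s (Y · ω))) (P x) := by
  have := hY.prob x
  refine Integrable.const_mul ?_ _
  exact Integrable.of_bound (hY.measurable_comp_shift hF s).aestronglyMeasurable 1
    (Eventually.of_forall fun ω => hF1 _)

/-- The Markov property at the first grid point outside `b`. -/
lemma IsCTMC.integral_gridExit (hY : IsCTMC G P Y) (hF : IsPathMeasurable F)
    (hF1 : ∀ f, ‖F f‖ ≤ 1) (q : ℂ) (K : ℝ≥0) (n : ℕ) (x : S) :
    ∫ ω, gridExit K b n (fun t => expNeg q t * F (shift t (Y · ω))) (Y · ω) ∂(P x) =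
      ∑ z, ((∑ k ∈ Finset.range (n + 1), (Complex.exp (-q * mesh K n) •
        skeleton G b K n) ^ k) * (1 - indMat b)) x z * ∫ ω, F (Y · ω) ∂(P z) := by
  simp_rw [gridExit_eq_sum Y b K n (fun ω t => expNeg q t * F (shift t (Y · ω)))]
  rw [integral_finsetSum _ fun k _ =>
    (hY.integrable_restart hF hF1 x _ _).indicator (hY.measurableSet_gridStay_exit K n k)]
  simp_rw [one_sub_indMat, mul_indMat_apply, Matrix.sum_apply, ite_mul, zero_mul, Finset.sum_mul]
  have hterm : ∀ k ∈ Finset.range (n + 1),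
      ∫ ω, (gridStay Y b K n k ∩ {ω | ¬ b (Y (gridPt K n k) ω)}).indicator
        (fun ω => expNeg q (gridPt K n k) * F (shift (gridPt K n k) (Y · ω))) ω ∂(P x) =
      ∑ z, if ¬ b z then ((Complex.exp (-q * mesh K n) • skeleton G b K n) ^ k) x z *
        ∫ ω, F (Y · ω) ∂(P z) else 0 := by
    intro k _
    rw [integral_indicator (hY.measurableSet_gridStay_exit K n k),
      setIntegral_eq_sum_state hY x (gridPt K n k) (hY.measurableSet_gridStay_exit K n k)
        (hY.integrable_restart hF hF1 x _ _)]
    refine Finset.sum_congr rfl fun z _ => ?_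
    by_cases hb : ¬ b z
    · rw [if_pos hb]
      have : gridStay Y b K n k ∩ {ω | ¬ b (Y (gridPt K n k) ω)} ∩ {ω | Y (gridPt K n k) ω = z} =
          gridStay Y b K n k ∩ {ω | Y (gridPt K n k) ω = z} := by
        ext ω
        simp only [Set.mem_inter_iff, Set.mem_ofPred_eq]
        constructor
        · rintro ⟨⟨h1, -⟩, h2⟩
          exact ⟨h1, h2⟩
        · rintro ⟨h1, h2⟩
          exact ⟨⟨h1, by rwa [h2]⟩, h2⟩
      rw [this, integral_const_mul,
        hY.setIntegral_shift hF x z _ (measurableSet_gridStay Y b K n k), hY.real_gridStay,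
        smul_pow, expNeg_gridPt, Matrix.smul_apply, smul_eq_mul, mul_assoc]
    · rw [if_neg hb]
      have : gridStay Y b K n k ∩ {ω | ¬ b (Y (gridPt K n k) ω)} ∩ {ω | Y (gridPt K n k) ω = z} =
          ∅ := by
        refine Set.eq_empty_of_forall_notMem fun ω hω => ?_
        have h3 : Y (gridPt K n k) ω = z := hω.2
        have h2 := hω.1.2
        simp only [Set.mem_ofPred_eq, h3] at h2
        exact hb h2
      rw [this, setIntegral_empty]
  rw [Finset.sum_congr rfl hterm, Finset.sum_comm]
  refine Finset.sum_congr rfl fun z _ => ?_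
  split_ifs <;> simp

variable {H : (ℝ≥0 → S) → ℂ}

/-- The strong Markov property at the first exit from `b`, before time `K`. -/
lemma IsCTMC.integral_exit_before (hY : IsCTMC G P Y) (hF : IsPathMeasurable F)
    (hF1 : ∀ f, ‖F f‖ ≤ 1) {q : ℂ} (hq : 0 < q.re) {K : ℝ≥0} (hK : 0 < K) (x : S)
    (h0 : ∀ f, IsRightConst f → f 0 = x → (∀ t < K, b (f t)) → H f = 0)
    (h1 : ∀ f, IsRightConst f → f 0 = x → ∀ T, IsLeast {t | ¬ b (f t)} T → T < K →
      Tendsto (fun t : ℝ≥0 => expNeg q t * F (shift t f)) (𝓝[≥] T) (𝓝 (H f))) :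
    AEStronglyMeasurable (fun ω => H (Y · ω)) (P x) ∧
      ∫ ω, H (Y · ω) ∂(P x) = ∑ z, exitMatBefore G b q K x z * ∫ ω, F (Y · ω) ∂(P z) := by
  have := hY.prob x
  have hlim : ∀ᵐ ω ∂(P x), Tendsto (fun n =>
      gridExit K b n (fun t => expNeg q t * F (shift t (Y · ω))) (Y · ω)) atTop
      (𝓝 (H (Y · ω))) := by
    filter_upwards [hY.ae_start x] with ω hω
    have hf := hY.isRightConst ω
    by_cases h : ∀ t < K, b (Y t ω)
    · rw [h0 _ hf hω h]
      exact tendsto_const_nhds.congr fun n => (gridExit_eq_zero hK h n _).symm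
    · push Not at h
      obtain ⟨t, htK, ht⟩ := h
      rcases (hf.isRightClosed fun z => ¬ b z).eq_empty_or_isLeast with he | ⟨T, hT⟩
      · exact absurd (show t ∈ {t | ¬ b (Y t ω)} from ht) (by rw [he]; exact id)
      · have hTK : T < K := (hT.2 ht).trans_lt htK
        exact tendsto_gridExit hK hf hT hTK (h1 _ hf hω T hT hTK)
  have hmeas : ∀ n, AEStronglyMeasurable (fun ω =>
      gridExit K b n (fun t => expNeg q t * F (shift t (Y · ω))) (Y · ω)) (P x) := fun n =>
    (hY.measurable_gridExit hF q K n).aestronglyMeasurable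
  refine ⟨aestronglyMeasurable_of_tendsto_ae atTop hmeas hlim, ?_⟩
  have hbound : ∀ n, ∀ᵐ ω ∂(P x),
      ‖gridExit K b n (fun t => expNeg q t * F (shift t (Y · ω))) (Y · ω)‖ ≤ 1 := fun n =>
    Eventually.of_forall fun ω => norm_gridExit_le K b n _ zero_le_one fun t => by
      rw [norm_mul]
      exact mul_le_one₀ (norm_expNeg_le_one hq _) (norm_nonneg _) (hF1 _)
  refine tendsto_nhds_unique
    (tendsto_integral_of_dominated_convergence (fun _ => 1) hmeas (integrable_const _) hbound hlim) ?_
  simp_rw [hY.integral_gridExit hF hF1]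
  exact tendsto_finsetSum _ fun z _ =>
    (hY.rate.tendsto_skeleton_geom_sum_apply hq hK x z).mul_const _

lemma IsCTMC.tendsto_exitMatBefore (hY : IsCTMC G P Y) {q : ℂ} (hq : 0 < q.re) (x z : S) :
    Tendsto (fun n : ℕ => exitMatBefore G b q (n + 1) x z) atTop (𝓝 (exitMat G b q x z)) := by
  have hexp : Tendsto (fun n : ℕ => ‖Complex.exp (-q * ((((n : ℝ≥0) + 1 : ℝ≥0) : ℝ) : ℂ))‖) atTop
      (𝓝 0) := by
    have h1 : Tendsto (fun n : ℕ => -q.re * ((n : ℝ) + 1)) atTop atBot :=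
      (tendsto_natCast_atTop_atTop.atTop_add tendsto_const_nhds).const_mul_atTop_of_neg (by linarith)
    refine (Real.tendsto_exp_atBot.comp h1).congr fun n => ?_
    rw [Complex.norm_exp]
    simp
  have hsmall : Tendsto (fun n : ℕ => (Complex.exp (-q * ((((n : ℝ≥0) + 1 : ℝ≥0) : ℝ) : ℂ)) •
      (killed G b (n + 1) * exitMat G b q)) x z) atTop (𝓝 0) := by
    have h2 := hexp.mul_const (∑ y, ‖exitMat G b q y z‖)
    rw [zero_mul] at h2
    refine squeeze_zero_norm (fun n => ?_) h2
    rw [Matrix.smul_apply, norm_smul, Matrix.mul_apply]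
    refine mul_le_mul_of_nonneg_left ((norm_sum_le _ _).trans (Finset.sum_le_sum fun y _ => ?_))
      (norm_nonneg _)
    rw [norm_mul]
    exact mul_le_of_le_one_left (norm_nonneg _) (hY.norm_killed_le_one (by positivity) x y)
  simpa [exitMatBefore] using (tendsto_const_nhds (x := exitMat G b q x z)).sub hsmall

open Classical in
/-- The strong Markov property at the first exit from `b`. -/
lemma IsCTMC.integral_exit (hY : IsCTMC G P Y) (hF : IsPathMeasurable F)
    (hF1 : ∀ f, ‖F f‖ ≤ 1) (hH1 : ∀ f, ‖H f‖ ≤ 1) {q : ℂ} (hq : 0 < q.re) (x : S)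
    (h0 : ∀ f, IsRightConst f → f 0 = x → (∀ t, b (f t)) → H f = 0)
    (h1 : ∀ f, IsRightConst f → f 0 = x → ∀ T, IsLeast {t | ¬ b (f t)} T →
      Tendsto (fun t : ℝ≥0 => expNeg q t * F (shift t f)) (𝓝[≥] T) (𝓝 (H f))) :
    AEStronglyMeasurable (fun ω => H (Y · ω)) (P x) ∧
      ∫ ω, H (Y · ω) ∂(P x) = ∑ z, exitMat G b q x z * ∫ ω, F (Y · ω) ∂(P z) := by
  have := hY.prob x
  have key := fun n : ℕ => hY.integral_exit_before (b := b)
    -- The payoff is truncated to `0` on paths that stay in `b` up to the horizon `n + 1`. The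
    -- truncations converge to `H` as the horizon grows, and stay bounded by `1`.
    (H := fun f => if ∀ t < (n : ℝ≥0) + 1, b (f t) then 0 else H f) hF hF1 hq
    (K := n + 1) (by positivity) x (fun f _ _ h => if_pos h) (fun f hf hx T hT hTK => by
      rw [if_neg fun h => hT.1 (h T hTK)]
      exact h1 f hf hx T hT)
  have hlim : ∀ᵐ ω ∂(P x), Tendsto (fun n : ℕ =>
      if ∀ t < (n : ℝ≥0) + 1, b (Y t ω) then 0 else H (Y · ω)) atTop (𝓝 (H (Y · ω))) := by
    filter_upwards [hY.ae_start x] with ω hω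
    by_cases h : ∀ t, b (Y t ω)
    · rw [h0 _ (hY.isRightConst ω) hω h]
      simp
    · push Not at h
      obtain ⟨t, ht⟩ := h
      refine tendsto_const_nhds.congr' ?_
      obtain ⟨m, hm⟩ := exists_nat_gt t
      filter_upwards [eventually_ge_atTop m] with n hn
      refine (if_neg fun h => ht (h t ?_)).symm
      calc t < m := hm
        _ ≤ n := by exact_mod_cast hn
        _ ≤ n + 1 := le_self_add
  refine ⟨aestronglyMeasurable_of_tendsto_ae atTop (fun n => (key n).1) hlim, ?_⟩
  refine tendsto_nhds_unique (tendsto_integral_of_dominated_convergence (fun _ => 1)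
    (fun n => (key n).1) (integrable_const _) (fun n => Eventually.of_forall fun ω => ?_) hlim) ?_
  · split_ifs
    · simp
    · exact hH1 _
  · simp_rw [fun n => (key n).2]
    exact tendsto_finsetSum _ fun z _ => (hY.tendsto_exitMatBefore hq x z).mul_const _

end Grid

/-! ### First passage quantities and the matrix formulas -/

section Passage

variable {S : Finset ℝ} (G : Matrix S S ℝ)

/-- The states below `L`. -/
abbrev below (L : ℝ) (x : S) : Prop := (x : ℝ) < L

/-- The states above `L`. -/
abbrev above (L : ℝ) (x : S) : Prop := L ≤ (x : ℝ)

lemma IBelow_eq (L : ℝ) : IBelow S L = indMat (below L) := rfl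

lemma IAbove_eq (L : ℝ) : IAbove S L = indMat (above L) := rfl

lemma one_sub_IBelow (L : ℝ) : 1 - IBelow S L = IAbove S L := by
  rw [IBelow_eq, one_sub_indMat]
  simp [indMat, IAbove]

lemma one_sub_IAbove (L : ℝ) : 1 - IAbove S L = IBelow S L := by
  rw [← one_sub_IBelow, sub_sub_cancel]

lemma resolvBelow_eq (L : ℝ) (q : ℂ) : resolvBelow G L q = exitResolv G (below L) q := by
  rw [exitResolv, ← IBelow_eq, one_sub_IBelow, resolvBelow, mul_sub, mul_smul_comm, mul_one]

lemma resolvAbove_eq (L : ℝ) (q : ℂ) : resolvAbove G L q = exitResolv G (above L) q := by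
  rw [exitResolv, ← IAbove_eq, one_sub_IAbove, resolvAbove, mul_sub, mul_smul_comm, mul_one]

lemma matV_eq (L : ℝ) (D : ℝ≥0) : matV G L D = killed G (below L) D := rfl

lemma matU1_eq (L : ℝ) (q : ℂ) : matU1 G L q = exitMat G (below L) q := by
  rw [matU1, exitMat, resolvBelow_eq, ← IBelow_eq, one_sub_IBelow]

lemma matUDown_eq (L : ℝ) (q : ℂ) : matUDown G L q = exitMat G (above L) q := by
  rw [matUDown, exitMat, resolvAbove_eq, ← IAbove_eq, one_sub_IAbove]

lemma matU1_sub_matU2 (L : ℝ) (D : ℝ≥0) (q : ℂ) :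
    matU1 G L q - matU2 G L D q = exitMatBefore G (below L) q D := by
  rw [matU2, matU1_eq]
  rfl

lemma matU_apply (L : ℝ) (D : ℝ≥0) (q : ℂ) (x z : S) : matU G L D q x z =
    if (x : ℝ) < L then exitMatBefore G (below L) q D x z else exitMat G (above L) q x z := by
  rw [matU, ← mul_sub, matU1_sub_matU2, matUDown_eq, Matrix.add_apply, IBelow_eq, IAbove_eq,
    indMat_mul_apply, indMat_mul_apply]
  by_cases h : (x : ℝ) < L
  · simp [above, below, h]
  · simp [above, below, h, not_lt.1 h]

variable {G} {b : S → Prop} [DecidablePred b]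

lemma killed_apply_eq_zero {y : S} (hy : ¬ b y) (K : ℝ≥0) (x : S) : killed G b K x y = 0 := by
  rw [killed, mul_indMat_apply, if_neg hy]

lemma exitMat_apply_eq_zero {z : S} (hz : b z) (q : ℂ) (x : S) : exitMat G b q x z = 0 := by
  rw [exitMat, one_sub_indMat, mul_indMat_apply, if_neg (not_not.2 hz)]

lemma exitMatBefore_apply_eq_zero {z : S} (hz : b z) (q : ℂ) (K : ℝ≥0) (x : S) :
    exitMatBefore G b q K x z = 0 := by
  simp [exitMatBefore, Matrix.mul_apply, exitMat_apply_eq_zero hz]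

lemma le_upTime_iff (f : ℝ≥0 → S) (L : ℝ) (D : ℝ≥0) :
    (D : ℝ≥0∞) ≤ upTime f L ↔ ∀ t < D, below L (f t) := by
  constructor
  · intro h t ht
    by_contra hc
    have h1 : upTime f L ≤ t := firstTime_le (not_lt.1 hc)
    exact absurd (h.trans h1) (not_le.2 (by exact_mod_cast ht))
  · intro h
    refine le_firstTime fun t ht => ?_
    by_contra hc
    exact absurd (h t (by exact_mod_cast not_le.1 hc)) (not_lt.2 ht)

lemma upTime_eq (f : ℝ≥0 → S) (L : ℝ) : upTime f L = firstTime {t | ¬ below L (f t)} := by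
  simp [upTime, below]

lemma downTime_eq (f : ℝ≥0 → S) (L : ℝ) : downTime f L = firstTime {t | ¬ above L (f t)} := by
  simp [downTime, above]

lemma tendsto_expNeg_mul_state {f : ℝ≥0 → S} (hf : IsRightConst f) (q : ℂ) (z : S) (T : ℝ≥0) :
    Tendsto (fun t : ℝ≥0 => expNeg q t * (if shift t f 0 = z then 1 else 0)) (𝓝[≥] T)
      (𝓝 (expNeg q T * (if f T = z then 1 else 0))) := by
  have h1 : Tendsto (fun t : ℝ≥0 => expNeg q t * (if f T = z then 1 else 0)) (𝓝[≥] T)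
      (𝓝 (expNeg q T * (if f T = z then 1 else 0))) :=
    (((continuous_expNeg_coe q).tendsto T).mono_left nhdsWithin_le_nhds).mul_const _
  refine h1.congr' ?_
  filter_upwards [hf T] with t ht
  simp [shift, ht]

lemma isPathMeasurable_state (z : S) :
    IsPathMeasurable fun f : ℝ≥0 → S => if f 0 = z then 1 else 0 :=
  ⟨_, Measurable.ite (measurableSet_eq_fun (measurable_pi_apply 0) measurable_const)
    measurable_const measurable_const, fun _ _ => rfl⟩

lemma norm_ite_one_zero_le (p : Prop) [Decidable p] : ‖(if p then 1 else 0 : ℂ)‖ ≤ 1 := by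
  split_ifs <;> simp

variable {Ω : Type*} [MeasurableSpace Ω] {P : S → Measure Ω} {Y : ℝ≥0 → Ω → S}

/-- The indicators partition the space, so the sum is at most the mean of `‖φ‖`, which is below `1`
because `1 - ‖φ‖` is almost everywhere positive. -/
lemma sum_norm_integral_lt_one {μ : Measure Ω} [IsProbabilityMeasure μ] {φ : Ω → ℂ} {σ : Ω → S}
    (hφ : ∀ z, AEStronglyMeasurable (fun ω => φ ω * (if σ ω = z then 1 else 0)) μ)
    (h1 : ∀ᵐ ω ∂μ, ‖φ ω‖ < 1) :
    ∑ z, ‖∫ ω, φ ω * (if σ ω = z then 1 else 0) ∂μ‖ < 1 := by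
  have hint : ∀ z, Integrable (fun ω => φ ω * (if σ ω = z then 1 else 0)) μ := fun z => by
    refine Integrable.of_bound (hφ z) 1 ?_
    filter_upwards [h1] with ω hω
    rw [norm_mul]
    exact mul_le_one₀ hω.le (norm_nonneg _) (norm_ite_one_zero_le _)
  have hsum : ∀ ω, ∑ z, ‖φ ω * (if σ ω = z then 1 else 0)‖ = ‖φ ω‖ := fun ω => by
    rw [Finset.sum_eq_single (σ ω)]
    · simp
    · intro z _ hz
      simp [hz.symm]
    · simp
  have hint' : Integrable (fun ω => ‖φ ω‖) μ := by
    simp_rw [← hsum]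
    exact integrable_finsetSum _ fun z _ => (hint z).norm
  calc ∑ z, ‖∫ ω, φ ω * (if σ ω = z then 1 else 0) ∂μ‖
      ≤ ∑ z, ∫ ω, ‖φ ω * (if σ ω = z then 1 else 0)‖ ∂μ :=
        Finset.sum_le_sum fun z _ => norm_integral_le_integral_norm _
    _ = ∫ ω, ‖φ ω‖ ∂μ := by
        rw [← integral_finsetSum _ fun z _ => (hint z).norm]
        simp_rw [hsum]
    _ < 1 := by
        have h2 : 0 < ∫ ω, (1 - ‖φ ω‖) ∂μ := by
          rw [integral_pos_iff_support_of_nonneg_ae]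
          · have : (Function.support fun ω => 1 - ‖φ ω‖) =ᵐ[μ] Set.univ := by
              filter_upwards [h1] with ω hω
              exact propext ⟨fun _ => trivial, fun _ => (sub_pos.2 hω).ne'⟩
            rw [measure_congr this]
            simp
          · filter_upwards [h1] with ω hω
            exact (sub_pos.2 hω).le
          · exact (integrable_const _).sub hint'
        rw [integral_sub (integrable_const _) hint'] at h2
        simpa using h2

end Passage

/-! ### The linear system -/

section MainResult

variable {S : Finset ℝ} {G : Matrix S S ℝ} {Ω : Type*} [MeasurableSpace Ω] {P : S → Measure Ω}
  {Y : ℝ≥0 → Ω → S}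

lemma IsCTMC.integral_state (hY : IsCTMC G P Y) (w z : S) :
    ∫ ω, (if Y 0 ω = z then 1 else 0 : ℂ) ∂(P w) = if w = z then 1 else 0 := by
  have := hY.prob w
  have h : ∀ᵐ ω ∂(P w), (if Y 0 ω = z then 1 else 0 : ℂ) = if w = z then 1 else 0 := by
    filter_upwards [hY.ae_start w] with ω hω
    rw [hω]
  rw [integral_congr_ae h]
  simp

/-- The restarted functional is the indicator of the initial state, so its means form the identity
matrix and the exit matrix itself remains. Measurability is recorded for the later bound on row
sums. -/
lemma IsCTMC.uUp_eq (hY : IsCTMC G P Y) (L : ℝ) {D : ℝ≥0} (hD : 0 < D) {q : ℂ} (hq : 0 < q.re)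
    (x z : S) :
    AEStronglyMeasurable (fun ω => expNeg q (upTime (Y · ω) L) *
      (if upTime (Y · ω) L < (D : ℝ≥0∞) then 1 else 0) *
      (if Y (upTime (Y · ω) L).toNNReal ω = z then 1 else 0)) (P x) ∧
    uUp P Y L D q x z = exitMatBefore G (below L) q D x z := by
  have key := hY.integral_exit_before (b := below L) (isPathMeasurable_state z)
    (fun f => norm_ite_one_zero_le _) hq hD x
    (H := fun f => expNeg q (upTime f L) * (if upTime f L < (D : ℝ≥0∞) then 1 else 0) *
      (if f (upTime f L).toNNReal = z then 1 else 0))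
    (fun f hf hx h => by
      rw [if_neg (not_lt.2 ((le_upTime_iff f L D).2 h))]
      simp)
    (fun f hf hx T hT hTD => by
      rw [upTime_eq, firstTime_eq_of_isLeast hT, if_pos (by exact_mod_cast hTD), mul_one,
        ENNReal.toNNReal_coe]
      exact tendsto_expNeg_mul_state hf q z T)
  refine ⟨key.1, key.2.trans ?_⟩
  simp_rw [hY.integral_state]
  simp

lemma IsCTMC.uDown_eq (hY : IsCTMC G P Y) (L : ℝ) {q : ℂ} (hq : 0 < q.re) (x z : S) :
    AEStronglyMeasurable (fun ω => expNeg q (downTime (Y · ω) L) *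
      (if Y (downTime (Y · ω) L).toNNReal ω = z then 1 else 0)) (P x) ∧
    uDown P Y L q x z = exitMat G (above L) q x z := by
  have key := hY.integral_exit (b := above L) (isPathMeasurable_state z)
    (fun f => norm_ite_one_zero_le _)
    (H := fun f => expNeg q (downTime f L) * (if f (downTime f L).toNNReal = z then 1 else 0))
    (fun f => by
      rw [norm_mul]
      exact mul_le_one₀ (norm_expNeg_le_one hq _) (norm_nonneg _) (norm_ite_one_zero_le _)) hq x
    (fun f hf hx h => by
      have : {t | ¬ above L (f t)} = ∅ :=
        Set.eq_empty_of_forall_notMem fun t ht => ht (h t)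
      rw [downTime_eq, this, firstTime_empty, expNeg_top, zero_mul])
    (fun f hf hx T hT => by
      rw [downTime_eq, firstTime_eq_of_isLeast hT, ENNReal.toNNReal_coe]
      exact tendsto_expNeg_mul_state hf q z T)
  refine ⟨key.1, key.2.trans ?_⟩
  simp_rw [hY.integral_state]
  simp

lemma IsCTMC.v_eq (hY : IsCTMC G P Y) (L : ℝ) {D : ℝ≥0} (hD : 0 < D) (x y : S) :
    (v P Y L D x y : ℂ) = killed G (below L) D x y := by
  rw [← hY.real_stay hD, v]
  simp_rw [le_upTime_iff]

lemma IsCTMC.v_eq_zero_of_above (hY : IsCTMC G P Y) {L : ℝ} {D : ℝ≥0} (hD : 0 < D) {x : S}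
    (hx : L ≤ (x : ℝ)) (y : S) : v P Y L D x y = 0 := by
  have := hY.prob x
  rw [v, measureReal_eq_zero_iff, ← compl_mem_ae_iff]
  filter_upwards [hY.ae_start x] with ω hω hmem
  have h1 := (le_upTime_iff _ L D).1 hmem.1 0 hD
  rw [hω] at h1
  exact absurd h1 (not_lt.2 hx)

/-- The event `τ⁺_L ≥ D` does not exclude a crossing exactly at `D`, where the clock would fail to
ring. Such a crossing has probability zero, since the columns of the killed semigroup outside `b`
vanish. -/
lemma IsCTMC.ae_below_of_stay (hY : IsCTMC G P Y) (L : ℝ) {D : ℝ≥0} (hD : 0 < D) (x : S) :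
    ∀ᵐ ω ∂(P x), (∀ t < D, below L (Y t ω)) → below L (Y D ω) := by
  have := hY.prob x
  have h : ∀ y : S, ∀ᵐ ω ∂(P x), ¬ below L y → ¬ ((∀ t < D, below L (Y t ω)) ∧ Y D ω = y) := by
    intro y
    by_cases hy : below L y
    · exact Eventually.of_forall fun ω h => absurd hy h
    · have h1 := hY.real_stay (b := below L) hD x y
      rw [killed_apply_eq_zero hy, Complex.ofReal_eq_zero, measureReal_eq_zero_iff,
        ← compl_mem_ae_iff] at h1
      filter_upwards [h1] with ω hω _
      exact hω
  filter_upwards [ae_all_iff.2 h] with ω hω hstay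
  by_contra hc
  exact hω (Y D ω) hc ⟨hstay, rfl⟩

lemma IsCTMC.integrable_parisianVal (hY : IsCTMC G P Y) (L : ℝ) {D : ℝ≥0} (hD : 0 < D) {q : ℂ}
    (hq : 0 < q.re) (x y : S) : Integrable (fun ω => parisianVal L D q y (Y · ω)) (P x) := by
  simpa [shift_zero] using hY.integrable_restart (isPathMeasurable_parisianVal L hD q y)
    (norm_parisianVal_le_one hq L D y) x 1 0

lemma IsCTMC.h_of_above (hY : IsCTMC G P Y) (L : ℝ) {D : ℝ≥0} (hD : 0 < D) {q : ℂ}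
    (hq : 0 < q.re) (x y : S) :
    h P Y L D q x y = ∑ z, exitMat G (above L) q x z * h P Y L D q z y := by
  refine (hY.integral_exit (b := above L) (isPathMeasurable_parisianVal L hD q y)
    (norm_parisianVal_le_one hq L D y) (norm_parisianVal_le_one hq L D y) hq x
    (fun f hf _ h => parisianVal_of_above hD q y h) fun f hf _ T hT => ?_).2
  refine tendsto_parisianVal_restart_below hf hD q y fun u hu => ?_
  by_contra hc
  exact absurd (hT.2 hc) (not_le.2 hu)

-- The payoff splits into its part on paths below `L` throughout `[0, D)`, where the clock almost
-- surely rings at `D`, and the part `H` on paths that cross before `D`, to which the strong Markov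
-- property applies.
open Classical in
lemma IsCTMC.h_of_below (hY : IsCTMC G P Y) (L : ℝ) {D : ℝ≥0} (hD : 0 < D) {q : ℂ}
    (hq : 0 < q.re) (x y : S) :
    h P Y L D q x y = Complex.exp (-q * ((D : ℝ) : ℂ)) * (v P Y L D x y : ℂ) +
      ∑ z, exitMatBefore G (below L) q D x z * h P Y L D q z y := by
  have := hY.prob x
  set H : (ℝ≥0 → S) → ℂ := fun f =>
    if ∀ t < D, below L (f t) then 0 else parisianVal L D q y f with hH
  obtain ⟨hmeas, hint⟩ := hY.integral_exit_before (b := below L) (H := H)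
    (isPathMeasurable_parisianVal L hD q y) (norm_parisianVal_le_one hq L D y) hq hD x
    (fun f _ _ h => if_pos h) (fun f hf hx T hT hTD => by
      rw [hH]
      beta_reduce
      rw [if_neg fun h => hT.1 (h T hTD)]
      refine tendsto_const_nhds.congr' ?_
      filter_upwards [hf T, Ico_mem_nhdsGE hTD] with t h1 h2
      refine parisianVal_restart_above hf hD q y ?_ h2.2
      rw [h1]
      exact not_lt.1 hT.1)
  have hHint : Integrable (fun ω => H (Y · ω)) (P x) := by
    refine Integrable.of_bound hmeas 1 (Eventually.of_forall fun ω => ?_)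
    simp only [hH]
    split_ifs
    · simp
    · exact norm_parisianVal_le_one hq L D y _
  set E : Set Ω := {ω | (∀ t < D, below L (Y t ω)) ∧ Y D ω = y} with hE
  have hEmeas : MeasurableSet E :=
    (hY.measurableSet_stay hD).inter (hY.meas D (measurableSet_singleton y))
  have hdiff : ∀ᵐ ω ∂(P x), parisianVal L D q y (Y · ω) =
      E.indicator (fun _ => expNeg q D) ω + H (Y · ω) := by
    filter_upwards [hY.ae_below_of_stay L hD x] with ω hω
    by_cases hs : ∀ t < D, below L (Y t ω)
    · have hle : ∀ t ≤ D, (Y t ω : ℝ) < L := fun t ht => by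
        rcases ht.lt_or_eq with h | rfl
        · exact hs t h
        · exact hω hs
      rw [parisianVal_of_below hD q y hle]
      simp only [hH, if_pos hs, add_zero, Set.indicator_apply]
      by_cases hy : Y D ω = y
      · rw [if_pos hy, if_pos ⟨hs, hy⟩, mul_one]
      · rw [if_neg hy, if_neg fun h => hy h.2, mul_zero]
    · simp only [hH, if_neg hs]
      rw [Set.indicator_of_notMem (fun h => hs h.1), zero_add]
  have hv : (v P Y L D x y : ℂ) = ((P x).real E : ℂ) := by
    rw [v, hE]
    simp_rw [le_upTime_iff]
  calc h P Y L D q x y = ∫ ω, (E.indicator (fun _ => expNeg q D) ω + H (Y · ω)) ∂(P x) :=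
        integral_congr_ae hdiff
    _ = _ := by
        rw [integral_add ((integrable_const _).indicator hEmeas) hHint, hint,
          integral_indicator hEmeas, setIntegral_const, Complex.real_smul, ← hv, expNeg_coe,
          mul_comm (v P Y L D x y : ℂ)]
        rfl

lemma IsCTMC.hTot_eq_sum (hY : IsCTMC G P Y) (L : ℝ) {D : ℝ≥0} (hD : 0 < D) {q : ℂ}
    (hq : 0 < q.re) (x : S) : hTot P Y L D q x = ∑ y, h P Y L D q x y := by
  have h1 : ∑ y, h P Y L D q x y = ∫ ω, ∑ y, parisianVal L D q y (Y · ω) ∂(P x) :=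
    (integral_finsetSum _ fun y _ => hY.integrable_parisianVal L hD hq x y).symm
  rw [h1, hTot]
  simp [parisianVal]

lemma IsCTMC.vTot_eq_sum (hY : IsCTMC G P Y) (L : ℝ) {D : ℝ≥0} (hD : 0 < D) (x : S) :
    vTot P Y L D x = ∑ y, v P Y L D x y := by
  have := hY.prob x
  have h := setIntegral_eq_sum_state hY x D (hY.measurableSet_stay (b := below L) hD)
    (integrable_const (1 : ℂ))
  simp only [setIntegral_const, Complex.real_smul, mul_one] at h
  simp_rw [vTot, v, le_upTime_iff]
  exact_mod_cast h

/-- The linear system for `h(q, x; y)`, with the coefficients given by `U(q)`. -/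
lemma IsCTMC.h_eq (hY : IsCTMC G P Y) (L : ℝ) {D : ℝ≥0} (hD : 0 < D) {q : ℂ} (hq : 0 < q.re)
    (x y : S) : h P Y L D q x y =
      Complex.exp (-q * ((D : ℝ) : ℂ)) * killed G (below L) D x y +
        ∑ z, matU G L D q x z * h P Y L D q z y := by
  simp_rw [matU_apply]
  by_cases hx : (x : ℝ) < L
  · simp_rw [if_pos hx]
    rw [← hY.v_eq L hD]
    exact hY.h_of_below L hD hq x y
  · simp_rw [if_neg hx]
    rw [← hY.v_eq L hD, hY.v_eq_zero_of_above hD (not_lt.1 hx), Complex.ofReal_zero, mul_zero,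
      zero_add]
    exact hY.h_of_above L hD hq x y

/-- Started above `L`, the path has already crossed at time `0`, so the corresponding rows of `V`
vanish. This is why `I_L⁻` may be dropped from the formula for the total transform. -/
lemma IsCTMC.IBelow_mul_matV (hY : IsCTMC G P Y) (L : ℝ) {D : ℝ≥0} (hD : 0 < D) :
    IBelow S L * matV G L D = matV G L D := by
  ext x y
  rw [IBelow_eq, indMat_mul_apply, matV_eq]
  split_ifs with hx
  · rfl
  · rw [← hY.v_eq L hD, hY.v_eq_zero_of_above hD (not_lt.1 hx), Complex.ofReal_zero]

lemma expNeg_firstTime_lt_one {q : ℂ} (hq : 0 < q.re) {b : S → Prop} {f : ℝ≥0 → S}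
    (hf : IsRightConst f) (h0 : b (f 0)) : ‖expNeg q (firstTime {t | ¬ b (f t)})‖ < 1 := by
  rcases (hf.isRightClosed fun z => ¬ b z).eq_empty_or_isLeast with he | ⟨T, hT⟩
  · rw [he, firstTime_empty, expNeg_top, norm_zero]
    exact one_pos
  · rw [firstTime_eq_of_isLeast hT]
    refine norm_expNeg_lt_one hq ?_
    have : T ≠ 0 := by
      rintro rfl
      exact hT.1 h0
    exact_mod_cast pos_iff_ne_zero.2 this

/-- A path starting strictly inside its region stays there for a positive time, so the discount
factor at the exit has modulus below `1`; the restriction to exits before `D` only decreases it. -/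
lemma IsCTMC.sum_norm_matU_lt_one (hY : IsCTMC G P Y) (L : ℝ) {D : ℝ≥0} (hD : 0 < D) {q : ℂ}
    (hq : 0 < q.re) (x : S) : ∑ z, ‖matU G L D q x z‖ < 1 := by
  have := hY.prob x
  simp_rw [matU_apply]
  by_cases hx : (x : ℝ) < L
  · simp_rw [if_pos hx, ← fun z => (hY.uUp_eq L hD hq x z).2]
    refine sum_norm_integral_lt_one (fun z => (hY.uUp_eq L hD hq x z).1) ?_
    filter_upwards [hY.ae_start x] with ω hω
    rw [norm_mul, upTime_eq]
    refine (mul_le_of_le_one_right (norm_nonneg _) (norm_ite_one_zero_le _)).trans_lt ?_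
    exact expNeg_firstTime_lt_one hq (hY.isRightConst ω) (by rwa [hω])
  · simp_rw [if_neg hx, ← fun z => (hY.uDown_eq L hq x z).2]
    refine sum_norm_integral_lt_one (fun z => (hY.uDown_eq L hq x z).1) ?_
    filter_upwards [hY.ae_start x] with ω hω
    rw [downTime_eq]
    exact expNeg_firstTime_lt_one hq (hY.isRightConst ω) (by rw [hω]; exact not_lt.1 hx)

/-- The bound on row sums makes `1 - A` strictly diagonally dominant. -/
lemma isUnit_one_sub_of_sum_norm_lt_one {n : Type*} [Fintype n] [DecidableEq n]
    {A : Matrix n n ℂ} (hA : ∀ x, ∑ z, ‖A x z‖ < 1) : IsUnit (1 - A) := by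
  rw [Matrix.isUnit_iff_isUnit_det, isUnit_iff_ne_zero]
  refine det_ne_zero_of_sum_row_lt_diag fun x => ?_
  have h1 : ∑ z ∈ Finset.univ.erase x, ‖(1 - A) x z‖ = ∑ z ∈ Finset.univ.erase x, ‖A x z‖ :=
    Finset.sum_congr rfl fun z hz => by
      rw [Matrix.sub_apply, Matrix.one_apply_ne (Finset.ne_of_mem_erase hz).symm, zero_sub, norm_neg]
  have h2 := Finset.sum_erase_add Finset.univ (fun z => ‖A x z‖) (Finset.mem_univ x)
  have h3 : 1 - ‖A x x‖ ≤ ‖(1 - A) x x‖ := by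
    rw [Matrix.sub_apply, Matrix.one_apply_eq]
    simpa using norm_sub_norm_le (1 : ℂ) (A x x)
  rw [h1]
  linarith [hA x]

/-- The linear system for `h(q, x; y)` in terms of the first passage quantities. -/
lemma IsCTMC.h_system (hY : IsCTMC G P Y) (L : ℝ) {D : ℝ≥0} (hD : 0 < D) {q : ℂ}
    (hq : 0 < q.re) (x y : S) : h P Y L D q x y =
      (if (x : ℝ) < L then 1 else 0) * Complex.exp (-q * ((D : ℝ) : ℂ)) * (v P Y L D x y : ℂ)
        + (if (x : ℝ) < L then 1 else 0) *
          ∑ z ∈ Finset.univ.filter (fun z : S => L ≤ (z : ℝ)),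
            uUp P Y L D q x z * h P Y L D q z y
        + (if L ≤ (x : ℝ) then 1 else 0) *
          ∑ z ∈ Finset.univ.filter (fun z : S => (z : ℝ) < L),
            uDown P Y L q x z * h P Y L D q z y := by
  by_cases hx : (x : ℝ) < L
  · rw [if_pos hx, if_neg (not_le.2 hx), one_mul, one_mul, zero_mul, add_zero,
      hY.h_of_below L hD hq x y]
    congr 1
    rw [Finset.sum_filter]
    refine Finset.sum_congr rfl fun z _ => ?_
    rw [(hY.uUp_eq L hD hq x z).2]
    split_ifs with hz
    · rfl
    · rw [exitMatBefore_apply_eq_zero (b := below L) (not_le.1 hz), zero_mul]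
  · rw [if_neg hx, if_pos (not_lt.1 hx), zero_mul, zero_mul, zero_mul, add_zero, zero_add, one_mul,
      hY.h_of_above L hD hq x y, Finset.sum_filter]
    refine Finset.sum_congr rfl fun z _ => ?_
    rw [(hY.uDown_eq L hq x z).2]
    split_ifs with hz
    · rfl
    · rw [exitMat_apply_eq_zero (b := above L) (not_lt.1 hz), zero_mul]

end MainResult

end Parisian

end

/-! ### The linear system, its matrix form and its solution -/

theorem mainTheorem4 {S : Finset ℝ} {Ω : Type*} [MeasurableSpace Ω] (G : Matrix S S ℝ)
    (P : S → Measure Ω) (Y : ℝ≥0 → Ω → S) (hY : Parisian.IsCTMC G P Y)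
    (L : ℝ) (D : ℝ≥0) (hD : 0 < D) (q : ℂ) (hq : 0 < q.re) :
    -- the linear system for `h(q, x; y)`
    (∀ x y : S, Parisian.h P Y L D q x y =
      (if (x : ℝ) < L then 1 else 0) * Complex.exp (-q * ((D : ℝ) : ℂ)) *
          (Parisian.v P Y L D x y : ℂ)
        + (if (x : ℝ) < L then 1 else 0) *
          ∑ z ∈ Finset.univ.filter (fun z : S => L ≤ (z : ℝ)), Parisian.uUp P Y L D q x z * Parisian.h P Y L D q z y
        + (if L ≤ (x : ℝ) then 1 else 0) *
          ∑ z ∈ Finset.univ.filter (fun z : S => (z : ℝ) < L), Parisian.uDown P Y L q x z * Parisian.h P Y L D q z y) ∧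
    -- the linear system for `h(q, x)`
    (∀ x : S, Parisian.hTot P Y L D q x =
      (if (x : ℝ) < L then 1 else 0) * Complex.exp (-q * ((D : ℝ) : ℂ)) *
          (Parisian.vTot P Y L D x : ℂ)
        + (if (x : ℝ) < L then 1 else 0) *
          ∑ z ∈ Finset.univ.filter (fun z : S => L ≤ (z : ℝ)), Parisian.uUp P Y L D q x z * Parisian.hTot P Y L D q z
        + (if L ≤ (x : ℝ) then 1 else 0) *
          ∑ z ∈ Finset.univ.filter (fun z : S => (z : ℝ) < L), Parisian.uDown P Y L q x z * Parisian.hTot P Y L D q z) ∧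
    (∀ x : S, Parisian.hTot P Y L D q x = ∑ y, Parisian.h P Y L D q x y) ∧
    (∀ x : S, Parisian.vTot P Y L D x = ∑ y, Parisian.v P Y L D x y) ∧
    -- the matrices of the first passage quantities
    IsUnit (Parisian.resolvBelow G L q) ∧
    IsUnit (Parisian.resolvAbove G L q) ∧
    (Matrix.of fun x y => (Parisian.v P Y L D x y : ℂ)) = Parisian.matV G L D ∧
    (Matrix.of fun x z => Parisian.uUp P Y L D q x z) =
      Parisian.matU1 G L q - Parisian.matU2 G L D q ∧
    (Matrix.of fun x z => Parisian.uDown P Y L q x z) = Parisian.matUDown G L q ∧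
    -- the system in matrix form and its unique solution
    Matrix.of (Parisian.h P Y L D q) =
      Complex.exp (-q * ((D : ℝ) : ℂ)) • (Parisian.IBelow S L * Parisian.matV G L D)
        + Parisian.matU G L D q * Matrix.of (Parisian.h P Y L D q) ∧
    IsUnit (1 - Parisian.matU G L D q) ∧
    Matrix.of (Parisian.h P Y L D q) =
      Complex.exp (-q * ((D : ℝ) : ℂ)) •
        ((1 - Parisian.matU G L D q)⁻¹ * Parisian.IBelow S L * Parisian.matV G L D) ∧
    Parisian.hTot P Y L D q =
      Complex.exp (-q * ((D : ℝ) : ℂ)) •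
        ((1 - Parisian.matU G L D q)⁻¹ * Parisian.matV G L D).mulVec 1 := by
  have hmat : Matrix.of (Parisian.h P Y L D q) =
      Complex.exp (-q * ((D : ℝ) : ℂ)) • (Parisian.IBelow S L * Parisian.matV G L D)
        + Parisian.matU G L D q * Matrix.of (Parisian.h P Y L D q) := by
    ext x y
    rw [hY.IBelow_mul_matV L hD, Matrix.add_apply, Matrix.smul_apply, Matrix.mul_apply, smul_eq_mul]
    exact hY.h_eq L hD hq x y
  have hunit : IsUnit (1 - Parisian.matU G L D q) :=
    Parisian.isUnit_one_sub_of_sum_norm_lt_one (hY.sum_norm_matU_lt_one L hD hq)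
  have hsol : Matrix.of (Parisian.h P Y L D q) =
      Complex.exp (-q * ((D : ℝ) : ℂ)) •
        ((1 - Parisian.matU G L D q)⁻¹ * Parisian.IBelow S L * Parisian.matV G L D) := by
    have h1 : (1 - Parisian.matU G L D q) * Matrix.of (Parisian.h P Y L D q) =
        Complex.exp (-q * ((D : ℝ) : ℂ)) • (Parisian.IBelow S L * Parisian.matV G L D) := by
      rw [sub_mul, one_mul, sub_eq_iff_eq_add]
      exact hmat
    rw [mul_assoc, ← mul_smul_comm, ← h1,
      Matrix.nonsing_inv_mul_cancel_left _ _ ((Matrix.isUnit_iff_isUnit_det _).1 hunit)]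
  refine ⟨hY.h_system L hD hq, fun x => ?_, hY.hTot_eq_sum L hD hq, hY.vTot_eq_sum L hD, ?_, ?_,
    ?_, ?_, ?_, hmat, hunit, hsol, ?_⟩
  -- The system for the totals is the sum over `y` of the system for `h(q, x; y)`, after exchanging
  -- the two finite sums.
  · simp_rw [hY.hTot_eq_sum L hD hq, hY.vTot_eq_sum L hD]
    rw [Finset.sum_congr rfl fun y _ => hY.h_system L hD hq x y]
    simp_rw [Finset.sum_add_distrib, Complex.ofReal_sum, Finset.mul_sum]
    exact congrArg₂ _ (congrArg₂ _ rfl Finset.sum_comm) Finset.sum_comm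
  · rw [Parisian.resolvBelow_eq]
    exact hY.rate.isUnit_exitResolv hq
  · rw [Parisian.resolvAbove_eq]
    exact hY.rate.isUnit_exitResolv hq
  · ext x y
    exact hY.v_eq L hD x y
  · rw [Parisian.matU1_sub_matU2]
    ext x z
    exact (hY.uUp_eq L hD hq x z).2
  · rw [Parisian.matUDown_eq]
    ext x z
    exact (hY.uDown_eq L hq x z).2
  · have h1 : Parisian.hTot P Y L D q = (Matrix.of (Parisian.h P Y L D q)).mulVec 1 := by
      funext x
      simp [Matrix.mulVec, dotProduct, hY.hTot_eq_sum L hD hq x]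
    rw [h1, hsol, mul_assoc, hY.IBelow_mul_matV L hD, Matrix.smul_mulVec]
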